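/- For $n\ge 1$ equip $\Lambda\mathbb C^n$ with the inner product for which the vectors $e_{i_1}\wedge\dots\wedge e_{i_p}$, $i_1<\dots<i_p$, form an orthonormal basis ($e_1,\dots,e_n$ the standard basis of $\mathbb C^n$). Let $a_j^*\colon\psi\mapsto e_j\wedge\psi$ be the creation operators, $a_j$ their adjoints (annihilation operators), and put $\phi_j=i(a_j+a_j^*)$, $\pi_j=a_j-a_j^*$ for $1\le j\le n$. Let $\mathrm{Cliff}_{2n}$ be the real associative algebra generated by $\mathbb R^{2n}$ with relations $vw+wv=-2\langle v,w\rangle$, and let $\mathrm{Spin}(2n)\subset\mathrm{Cliff}_{2n}$ be the multiplicative group generated by products of pairs of unit vectors. Sending the standard basis vectors of $\mathbb R^{2n}$ to the operators $\phi_1,\dots,\phi_n,\pi_1,\dots,\pi_n$, listed in any fixed order, makes $\Lambda\mathbb C^n$ a $\mathrm{Cliff}_{2n}$-module; its restriction to $\mathrm{Spin}(2n)$ is a unitary representation $\mathrm{Spin}(2n)\to \mathrm U(\Lambda\mathbb C^n)$, called a Dirac spinor representation. The Pati–Salam representation is the unitary representation of $\mathrm{SU}(2)\times\mathrm{SU}(2)\times\mathrm{SU}(4)$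 on $$V=\big((\mathbb C^2\otimes\mathbb C)\oplus(\mathbb C\otimes\mathbb C^2)\big)\otimes\big(\mathbb C^4\oplus\mathbb C^{4*}\big)$$ in which the first factor $\mathrm{SU}(2)$ acts by its fundamental representation on the $\mathbb C^2$ of $\mathbb C^2\otimes\mathbb C$, the second factor $\mathrm{SU}(2)$ acts by its fundamental representation on the $\mathbb C^2$ of $\mathbb C\otimes\mathbb C^2$, both act trivially on the other summand, and $\mathrm{SU}(4)$ acts on $\mathbb C^4\oplus\mathbb C^{4*}$ by the fundamental representation and its dual. Theorem. Fix any Dirac spinor representations of $\mathrm{Spin}(4)$ on $\Lambda\mathbb C^2$ and of $\mathrm{Spin}(6)$ on $\Lambda\mathbb C^3$ as above. There exist an isomorphism of Lie groups $$\alpha\colon \mathrm{SU}(2)\times\mathrm{SU}(2)\times\mathrm{SU}(4)\to\mathrm{Spin}(4)\times\mathrm{Spin}(6)$$ and a unitary operator $k\colon V\to\Lambda\mathbb C^2\otimes\Lambda\mathbb C^3$ such that the square $$\begin{array}{ccc} \mathrm{SU}(2)\times\mathrm{SU}(2)\times\mathrm{SU}(4)&\xrightarrow{\ \alpha\ }&\mathrm{Spin}(4)\times\mathrm{Spin}(6)\\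 \downarrow&&\downarrow\\ \mathrm U(V)&\xrightarrow{\ \mathrm U(k)\ }&\mathrm U(\Lambda\mathbb C^2\otimes\Lambda\mathbb C^3) \end{array}$$ commutes, where $\mathrm U(k)(g)=kgk^{-1}$, the left vertical arrow is the Pati–Salam representation and the right one is the tensor product of the Dirac spinor representations of $\mathrm{Spin}(4)$ and $\mathrm{Spin}(6)$. -/

import Mathlib

open scoped ContDiff TensorProduct InnerProductSpace

noncomputable section

namespace PatiSalam

/-! ### Smooth maps between linear groups -/

/-- Linear coordinates on a finite-dimensional real vector space. -/
def coords (V : Type*) [AddCommGroup V] [Module ℝ V] [Module.Finite ℝ V] :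
    V ≃ₗ[ℝ] (Fin (Module.finrank ℝ V) → ℝ) :=
  (Module.finBasis ℝ V).equivFun

/-- Let `G` and `H` be embedded by `i` and `j` in finite-dimensional real vector spaces `V` and `W`.
A map `f : G → H` is smooth if near every point of `G` it is the restriction of a smooth (`C^∞`)
map from an open subset of `V` to `W`. When the images of `i` and `j` are embedded submanifolds,
for instance closed subgroups of the group of units of a finite-dimensional algebra,
this is smoothness for the submanifold structures. Smoothness of a map between the vector spaces
`V` and `W` is expressed in linear coordinates. -/
def IsSmooth {G H V W : Type*} [AddCommGroup V] [Module ℝ V] [Module.Finite ℝ V]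
    [AddCommGroup W] [Module ℝ W] [Module.Finite ℝ W] (i : G → V) (j : H → W) (f : G → H) : Prop :=
  ∀ g : G, ∃ (U : Set (Fin (Module.finrank ℝ V) → ℝ))
    (F : (Fin (Module.finrank ℝ V) → ℝ) → (Fin (Module.finrank ℝ W) → ℝ)),
    IsOpen U ∧ coords V (i g) ∈ U ∧ ContDiffOn ℝ ∞ F U ∧
      ∀ g' : G, coords V (i g') ∈ U → coords W (j (f g')) = F (coords V (i g'))

/-- An isomorphism of Lie groups: a group isomorphism which is smooth with smooth inverse. -/
def IsLieGroupIso {G H V W : Type*} [Group G] [Group H] [AddCommGroup V] [Module ℝ V]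
    [Module.Finite ℝ V] [AddCommGroup W] [Module ℝ W] [Module.Finite ℝ W]
    (i : G → V) (j : H → W) (α : G ≃* H) : Prop :=
  IsSmooth i j α ∧ IsSmooth j i α.symm

/-! ### Unitary representations -/

/-- The Hilbert space structure on the dual of a Hilbert space, for which the Riesz map
`E → E*` is an antiunitary isomorphism. The norm is the operator norm. -/
instance dualInnerProductSpace (E : Type*) [NormedAddCommGroup E] [InnerProductSpace ℂ E]
    [CompleteSpace E] : InnerProductSpace ℂ (StrongDual ℂ E) where
  inner f g := ⟪(InnerProductSpace.toDual ℂ E).symm g, (InnerProductSpace.toDual ℂ E).symm f⟫_ℂ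
  norm_sq_eq_re_inner f := by
    rw [← norm_sq_eq_re_inner, LinearIsometryEquiv.norm_map]
  conj_inner_symm f g := inner_conj_symm _ _
  add_left f g h := by rw [map_add, inner_add_right]
  smul_left f g r := by
    rw [LinearIsometryEquiv.map_smulₛₗ, inner_smul_right]

section Reps

variable {V W : Type*} [NormedAddCommGroup V] [InnerProductSpace ℂ V]
  [NormedAddCommGroup W] [InnerProductSpace ℂ W]

/-- The group `U(V)` of unitary operators on `V`. -/
abbrev U (V : Type*) [NormedAddCommGroup V] [InnerProductSpace ℂ V] : Type _ := V ≃ₗᵢ[ℂ] V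

/-- A unitary operator `k : V → W` induces the homomorphism `U(V) → U(W)`, `g ↦ k g k⁻¹`. -/
def unitaryConj (k : V ≃ₗᵢ[ℂ] W) : U V →* U W where
  toFun g := (k.symm.trans g).trans k
  map_one' := by ext x; simp
  map_mul' g h := by ext x; simp

/-- The tensor product of unitary operators. -/
def tensorU : U V × U W →* U (V ⊗[ℂ] W) where
  toFun g := TensorProduct.congrIsometry g.1 g.2
  map_one' := TensorProduct.congrIsometry_refl_refl
  map_mul' g h := by
    ext x
    induction x using TensorProduct.induction_on with
    | zero => simp
    | tmul x y => rfl
    | add x y hx hy => simp only [map_add, hx, hy]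

/-- The direct sum of unitary operators, acting on the Hilbert space direct sum. -/
def directSumU : U V × U W →* U (WithLp 2 (V × W)) where
  toFun g := LinearIsometryEquiv.withLpProdCongr 2 g.1 g.2
  map_one' := rfl
  map_mul' _ _ := rfl

/-- The action of a unitary operator on the dual space, `f ↦ f ∘ g⁻¹`. -/
def dualU [CompleteSpace V] : U V →* U (StrongDual ℂ V) where
  toFun g :=
    { toFun := fun f => f.comp (g.symm : V →L[ℂ] V)
      invFun := fun f => f.comp (g : V →L[ℂ] V)
      map_add' := fun f h => rfl
      map_smul' := fun c f => rfl
      left_inv := fun f => by ext x; simp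
      right_inv := fun f => by ext x; simp
      norm_map' := fun f => f.opNorm_comp_linearIsometryEquiv g.symm }
  map_one' := by ext f x; rfl
  map_mul' g h := by ext f x; rfl

end Reps

/-! ### The Pati--Salam representation -/

/-- The special unitary group `SU(n)`. -/
abbrev SU (n : ℕ) : Type := Matrix.specialUnitaryGroup (Fin n) ℂ

/-- The Hilbert space `ℂⁿ`. -/
abbrev C (n : ℕ) : Type := EuclideanSpace ℂ (Fin n)

/-- The fundamental representation of `SU(n)` on `ℂⁿ`. -/
def fund (n : ℕ) : SU n →* U (C n) where
  toFun g := Unitary.linearIsometryEquiv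
    ⟨Matrix.toEuclideanCLM (n := Fin n) (𝕜 := ℂ) g.1,
      Unitary.map_mem (Matrix.toEuclideanCLM (n := Fin n) (𝕜 := ℂ))
        (Matrix.specialUnitaryGroup_le_unitaryGroup g.2)⟩
  map_one' := by
    ext1 x
    change Matrix.toEuclideanCLM (n := Fin n) (𝕜 := ℂ) 1 x = x
    simp
  map_mul' g h := by
    ext1 x
    change Matrix.toEuclideanCLM (n := Fin n) (𝕜 := ℂ) (g.1 * h.1) x = _
    rw [map_mul]
    rfl

lemma fund_apply (n : ℕ) (g : SU n) (v : C n) :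
    fund n g v = WithLp.toLp 2 (g.1.mulVec v.ofLp) := rfl

/-- `(ℂ² ⊗ ℂ) ⊕ (ℂ ⊗ ℂ²)`. -/
abbrev IsospinSpace : Type := WithLp 2 ((C 2 ⊗[ℂ] ℂ) × (ℂ ⊗[ℂ] C 2))

/-- `ℂ⁴ ⊕ ℂ⁴*`. -/
abbrev ColorSpace : Type := WithLp 2 (C 4 × StrongDual ℂ (C 4))

/-- `((ℂ² ⊗ ℂ) ⊕ (ℂ ⊗ ℂ²)) ⊗ (ℂ⁴ ⊕ ℂ⁴*)`. -/
abbrev PatiSalamSpace : Type := IsospinSpace ⊗[ℂ] ColorSpace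

/-- The Pati--Salam representation of `SU(2) × SU(2) × SU(4)`: the first `SU(2)` acts on the `ℂ²` of
`ℂ² ⊗ ℂ`, the second one on the `ℂ²` of `ℂ ⊗ ℂ²`, and `SU(4)` acts on `ℂ⁴` and on its dual. -/
def patiSalamRep : SU 2 × SU 2 × SU 4 →* U PatiSalamSpace where
  toFun g := tensorU
    (directSumU (tensorU (fund 2 g.1, 1), tensorU (1, fund 2 g.2.1)),
     directSumU (fund 4 g.2.2, dualU (fund 4 g.2.2)))
  map_one' := by simp [← Prod.one_eq_mk]
  map_mul' g h := by
    have h1 (a b : U (C 2)) : tensorU (a * b, (1 : U ℂ)) = tensorU (a, 1) * tensorU (b, 1) := by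
      rw [← map_mul, Prod.mk_mul_mk, one_mul]
    have h2 (a b : U (C 2)) : tensorU ((1 : U ℂ), a * b) = tensorU (1, a) * tensorU (1, b) := by
      rw [← map_mul, Prod.mk_mul_mk, one_mul]
    simp only [Prod.fst_mul, Prod.snd_mul, map_mul, h1, h2]
    simp only [← map_mul, Prod.mk_mul_mk]

/-! ### The exterior algebra of `ℂⁿ` as a Hilbert space -/

/-- The exterior algebra `Λℂⁿ`. -/
abbrev Ext (n : ℕ) : Type := ExteriorAlgebra ℂ (C n)

/-- The basis of `Λℂⁿ` made of the elements `e_{i₁} ∧ ⋯ ∧ e_{iₚ}` with `i₁ < ⋯ < iₚ`, where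
`e₁, …, eₙ` is the standard basis of `ℂⁿ`. -/
def extBasis (n : ℕ) : Module.Basis (Finset (Fin n)) ℂ (Ext n) :=
  (EuclideanSpace.basisFun (Fin n) ℂ).toBasis.ExteriorAlgebra

/-- The Hermitian inner product on `Λℂⁿ` for which `extBasis n` is orthonormal. -/
@[reducible] def extCore (n : ℕ) : InnerProductSpace.Core ℂ (Ext n) where
  inner x y := ∑ S, star ((extBasis n).repr x S) * (extBasis n).repr y S
  conj_inner_symm x y := by simp [mul_comm]
  re_inner_nonneg x := by
    simp only [map_sum]
    refine Finset.sum_nonneg fun S _ => ?_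
    rw [RCLike.star_def, RCLike.conj_mul]
    norm_cast
    positivity
  add_left x y z := by simp [add_mul, Finset.sum_add_distrib]
  smul_left x y r := by simp [mul_assoc, Finset.mul_sum]
  definite x h := by
    have h2 : ∑ S, ‖(extBasis n).repr x S‖ ^ 2 = 0 := by
      have h3 : (((∑ S, ‖(extBasis n).repr x S‖ ^ 2 : ℝ)) : ℂ) = 0 := by
        rw [← h]
        push_cast
        exact Finset.sum_congr rfl fun S _ => (RCLike.conj_mul _).symm
      exact_mod_cast h3
    rw [Finset.sum_eq_zero_iff_of_nonneg fun S _ => by positivity] at h2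
    refine (extBasis n).ext_elem fun S => ?_
    simpa using h2 S (Finset.mem_univ S)

instance extNormedAddCommGroup (n : ℕ) : NormedAddCommGroup (Ext n) :=
  InnerProductSpace.Core.toNormedAddCommGroup (𝕜 := ℂ) (cd := extCore n)

instance extInnerProductSpace (n : ℕ) : InnerProductSpace ℂ (Ext n) :=
  InnerProductSpace.ofCore (extCore n).toCore

lemma ext_inner_def (n : ℕ) (x y : Ext n) :
    ⟪x, y⟫_ℂ = ∑ S, star ((extBasis n).repr x S) * (extBasis n).repr y S := rfl

/-! ### Creation and annihilation operators -/

/-- The creation operator `a_j^* : ψ ↦ e_j ∧ ψ`. -/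
def creation {n : ℕ} (j : Fin n) : Module.End ℂ (Ext n) :=
  LinearMap.mulLeft ℂ (ExteriorAlgebra.ι ℂ (EuclideanSpace.single j 1))

/-- The annihilation operator `a_j`, the contraction with the `j`-th coordinate functional. It is
the adjoint of `a_j^*`. -/
def annihilation {n : ℕ} (j : Fin n) : Module.End ℂ (Ext n) :=
  CliffordAlgebra.contractLeft (Q := (0 : QuadraticForm ℂ (C n))) (EuclideanSpace.projₗ j)

lemma contract_prod_eq_zero {n : ℕ} (d : Module.Dual ℂ (C n)) (l : List (C n))
    (h : ∀ v ∈ l, d v = 0) :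
    CliffordAlgebra.contractLeft (Q := (0 : QuadraticForm ℂ (C n))) d
      (l.map (ExteriorAlgebra.ι ℂ)).prod = 0 := by
  induction l with
  | nil => exact CliffordAlgebra.contractLeft_one ..
  | cons v l ih =>
    rw [List.map_cons, List.prod_cons]
    refine (CliffordAlgebra.contractLeft_ι_mul _ _ _).trans ?_
    rw [h v (by simp), ih fun w hw => h w (by simp [hw])]
    simp

lemma annihilation_extBasis {n : ℕ} (j : Fin n) (S : Finset (Fin n)) (h : j ∉ S) :
    annihilation j (extBasis n S) = 0 := by
  rw [extBasis, ExteriorAlgebra.basis_apply]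
  have := contract_prod_eq_zero (n := n) (EuclideanSpace.projₗ j)
    (List.ofFn fun i => (EuclideanSpace.basisFun (Fin n) ℂ).toBasis
      (Set.powersetCard.ofFinEmbEquiv.symm
        (Set.powersetCard.prodEquiv.symm S).2 i)) (by
    intro v hv
    rw [List.mem_ofFn] at hv
    obtain ⟨i, rfl⟩ := hv
    have hi : Set.powersetCard.ofFinEmbEquiv.symm (Set.powersetCard.prodEquiv.symm S).2 i ∈ S :=
      (Set.powersetCard.mem_range_ofFinEmbEquiv_symm_iff_mem
        (Set.powersetCard.prodEquiv.symm S).2 _).1 ⟨i, rfl⟩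
    have hne : j ≠ Set.powersetCard.ofFinEmbEquiv.symm (Set.powersetCard.prodEquiv.symm S).2 i :=
      fun e => h (e ▸ hi)
    simpa using hne)
  rw [List.map_ofFn] at this
  exact this

lemma ι_single {n : ℕ} (j : Fin n) :
    ExteriorAlgebra.ι ℂ (EuclideanSpace.single j (1 : ℂ)) = extBasis n {j} := by
  rw [extBasis, ExteriorAlgebra.basis_apply_ofCard _ (Finset.card_singleton j)]
  have : Set.powersetCard.ofFinEmbEquiv.symm
      (Set.powersetCard.ofCard (Finset.card_singleton j)) 0 = j := by
    have := (Set.powersetCard.mem_range_ofFinEmbEquiv_symm_iff_mem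
        (Set.powersetCard.ofCard (Finset.card_singleton j)) _).1 ⟨0, rfl⟩
    exact Finset.mem_singleton.1 this
  refine Eq.trans ?_ (ExteriorAlgebra.ιMulti_apply _).symm
  simp [this]

lemma creation_of_mem {n : ℕ} (j : Fin n) (S : Finset (Fin n)) (h : j ∈ S) :
    creation j (extBasis n S) = 0 := by
  change ExteriorAlgebra.ι ℂ (EuclideanSpace.single j (1 : ℂ)) * _ = _
  rw [ι_single]
  exact ExteriorAlgebra.basis_mul_of_not_disjoint _
    (Set.powersetCard.ofCard (rfl : Finset.card {j} = _))
    (Set.powersetCard.ofCard (rfl : S.card = _)) (by simpa using h)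

lemma creation_of_notMem {n : ℕ} (j : Fin n) (S : Finset (Fin n)) (h : j ∉ S) :
    ∃ ε : ℤˣ, creation j (extBasis n S) = ε • extBasis n (insert j S) := by
  have hd : Disjoint ({j} : Finset (Fin n)) S := by simpa using h
  have key := ExteriorAlgebra.basis_mul_of_disjoint (EuclideanSpace.basisFun (Fin n) ℂ).toBasis
    (Set.powersetCard.ofCard (rfl : Finset.card {j} = _))
    (Set.powersetCard.ofCard (rfl : S.card = _)) hd
  refine ⟨_, Eq.trans (?_ : _ = extBasis n {j} * extBasis n S) (key.trans (congrArg₂ _ rfl ?_))⟩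
  · rw [← ι_single]
    rfl
  · rw [extBasis]
    congr 1
    change Finset.disjUnion {j} S hd = insert j S
    simp

lemma inner_extBasis (n : ℕ) (S T : Finset (Fin n)) :
    ⟪extBasis n S, extBasis n T⟫_ℂ = if S = T then 1 else 0 := by
  rw [ext_inner_def]
  simp [Finsupp.single_apply]

/-- Creation and annihilation operators are adjoint to each other. -/
lemma inner_creation_left {n : ℕ} (j : Fin n) (x y : Ext n) :
    ⟪creation j x, y⟫_ℂ = ⟪x, annihilation j y⟫_ℂ := by
  have hb : ∀ S T : Finset (Fin n), ⟪creation j (extBasis n S), extBasis n T⟫_ℂ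
      = ⟪extBasis n S, annihilation j (extBasis n T)⟫_ℂ := by
    intro S T
    by_cases hT : j ∈ T
    · obtain ⟨ε, hε⟩ := creation_of_notMem j (T.erase j) (Finset.notMem_erase j T)
      rw [Finset.insert_erase hT] at hε
      have h2 : annihilation j (extBasis n T) = ε • extBasis n (T.erase j) := by
        have h3 : extBasis n T = ε • creation j (extBasis n (T.erase j)) := by
          rw [hε, smul_smul, Int.units_mul_self, one_smul]
        have h4 : annihilation j (creation j (extBasis n (T.erase j)))
            = extBasis n (T.erase j) := by
          have := CliffordAlgebra.contractLeft_ι_mul (Q := (0 : QuadraticForm ℂ (C n)))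
            (EuclideanSpace.projₗ j) (EuclideanSpace.single j (1 : ℂ)) (extBasis n (T.erase j))
          refine this.trans ?_
          have h5 := annihilation_extBasis j (T.erase j) (Finset.notMem_erase j T)
          rw [annihilation] at h5
          rw [h5]
          simp
        rw [h3, Units.smul_def, map_zsmul, h4, Units.smul_def]
      rw [h2]
      by_cases hS : j ∈ S
      · rw [creation_of_mem j S hS, inner_zero_left, Units.smul_def,
          ← Int.cast_smul_eq_zsmul ℂ, inner_smul_right, inner_extBasis, if_neg, mul_zero]
        intro h
        exact Finset.notMem_erase j T (h ▸ hS)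
      · by_cases hST : S = T.erase j
        · subst hST
          rw [hε]
          rcases Int.units_eq_one_or ε with rfl | rfl <;>
            simp [inner_extBasis, -inner_self_eq_norm_sq_to_K]
        · obtain ⟨ε', hε'⟩ := creation_of_notMem j S hS
          rw [hε', Units.smul_def, Units.smul_def, ← Int.cast_smul_eq_zsmul ℂ,
            ← Int.cast_smul_eq_zsmul ℂ, inner_smul_right, inner_smul_left, inner_extBasis,
            inner_extBasis, if_neg hST, if_neg, mul_zero, mul_zero]
          intro h
          exact hST (by rw [← h, Finset.erase_insert hS])
    · rw [annihilation_extBasis j T hT, inner_zero_right]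
      by_cases hS : j ∈ S
      · rw [creation_of_mem j S hS, inner_zero_left]
      · obtain ⟨ε', hε'⟩ := creation_of_notMem j S hS
        rw [hε', Units.smul_def, ← Int.cast_smul_eq_zsmul ℂ, inner_smul_left, inner_extBasis,
          if_neg, mul_zero]
        intro h
        exact hT (h ▸ Finset.mem_insert_self j S)
  have h1 : ∀ S y, ⟪creation j (extBasis n S), y⟫_ℂ
      = ⟪extBasis n S, annihilation j y⟫_ℂ := by
    intro S y
    rw [← (extBasis n).sum_repr y]
    simp only [map_sum, map_smul, inner_sum, inner_smul_right, hb]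
  rw [← (extBasis n).sum_repr x]
  simp only [map_sum, map_smul, sum_inner, inner_smul_left, h1]

lemma inner_annihilation_left {n : ℕ} (j : Fin n) (x y : Ext n) :
    ⟪annihilation j x, y⟫_ℂ = ⟪x, creation j y⟫_ℂ := by
  rw [← inner_conj_symm, ← inner_creation_left, inner_conj_symm]

/-! ### The Clifford algebra and the Dirac spinor representation -/

/-- The Clifford algebra of `ℝᵐ` with the relations `v w + w v = -2 ⟨v, w⟩`. -/
abbrev Cliff (m : ℕ) : Type :=
  CliffordAlgebra (QuadraticMap.weightedSumSquares ℝ fun _ : Fin m => (-1 : ℝ))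

instance (m : ℕ) : Module.Finite ℝ (Cliff m) :=
  have : Invertible (2 : ℝ) := invertibleOfNonzero two_ne_zero
  have : Module.Finite ℝ (ExteriorAlgebra ℝ (Fin m → ℝ)) :=
    Module.Finite.of_basis (Pi.basisFun ℝ (Fin m)).ExteriorAlgebra
  Module.Finite.equiv (CliffordAlgebra.equivExterior
    (QuadraticMap.weightedSumSquares ℝ fun _ : Fin m => (-1 : ℝ))).symm

/-- The group `Spin(m)`, the subgroup of the group of units of the Clifford algebra of `ℝᵐ`
consisting of the products of an even number of unit vectors. -/
abbrev Spin (m : ℕ) : Type :=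
  spinGroup (QuadraticMap.weightedSumSquares ℝ fun _ : Fin m => (-1 : ℝ))

/-- The operator `φ_j = i (a_j + a_j^*)`. -/
def phi {n : ℕ} (j : Fin n) : Module.End ℂ (Ext n) := Complex.I • (annihilation j + creation j)

/-- The operator `π_j = a_j - a_j^*`. -/
def piOp {n : ℕ} (j : Fin n) : Module.End ℂ (Ext n) := annihilation j - creation j

/-- Let the standard basis vectors of `ℝᵐ`, `m = 2n`, be mapped to the operators `φ_1, …, φ_n,
π_1, …, π_n` in the order given by the bijection `e`. This is the linear extension to `ℝᵐ`. -/
def gamma {n m : ℕ} (e : Fin n ⊕ Fin n ≃ Fin m) : (Fin m → ℝ) →ₗ[ℝ] Module.End ℂ (Ext n) where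
  toFun v := ∑ j, ((v (e (Sum.inl j)) : ℂ) • phi j + (v (e (Sum.inr j)) : ℂ) • piOp j)
  map_add' v w := by
    rw [← Finset.sum_add_distrib]
    refine Finset.sum_congr rfl fun j _ => ?_
    simp only [Pi.add_apply, Complex.ofReal_add, add_smul]
    abel
  map_smul' r v := by
    rw [RingHom.id_apply, Finset.smul_sum]
    refine Finset.sum_congr rfl fun j _ => ?_
    rw [smul_add]
    simp only [Pi.smul_apply, smul_eq_mul, Complex.ofReal_mul, mul_smul]
    rfl

lemma gamma_apply {n m : ℕ} (e : Fin n ⊕ Fin n ≃ Fin m) (v : Fin m → ℝ) :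
    gamma e v = ∑ j, ((v (e (Sum.inl j)) : ℂ) • phi j + (v (e (Sum.inr j)) : ℂ) • piOp j) := rfl

lemma gamma_eq {n m : ℕ} (e : Fin n ⊕ Fin n ≃ Fin m) (v : Fin m → ℝ) :
    gamma e v = CliffordAlgebra.contractLeft (Q := (0 : QuadraticForm ℂ (C n)))
        (∑ j, (v (e (Sum.inl j)) * Complex.I + v (e (Sum.inr j))) •
          (EuclideanSpace.projₗ j : C n →ₗ[ℂ] ℂ))
      + LinearMap.mulLeft ℂ (ExteriorAlgebra.ι ℂ
        (∑ j, (v (e (Sum.inl j)) * Complex.I - v (e (Sum.inr j))) •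
          (EuclideanSpace.single j 1 : C n))) := by
  have hm : ∀ u : C n, LinearMap.mulLeft ℂ (ExteriorAlgebra.ι ℂ u)
      = (LinearMap.mul ℂ (Ext n)) (ExteriorAlgebra.ι ℂ u) := fun _ => rfl
  rw [gamma_apply, hm, map_sum, map_sum, map_sum, ← Finset.sum_add_distrib]
  refine Finset.sum_congr rfl fun j _ => ?_
  rw [map_smul, map_smul, map_smul, phi, piOp]
  change _ = _ • annihilation j + _ • creation j
  module

lemma gamma_mul_self {n m : ℕ} (e : Fin n ⊕ Fin n ≃ Fin m) (v : Fin m → ℝ) :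
    gamma e v * gamma e v = algebraMap ℝ (Module.End ℂ (Ext n))
      (QuadraticMap.weightedSumSquares ℝ (fun _ : Fin m => (-1 : ℝ)) v) := by
  rw [gamma_eq]
  set d : Module.Dual ℂ (C n) := ∑ j, (v (e (Sum.inl j)) * Complex.I + v (e (Sum.inr j))) •
    (EuclideanSpace.projₗ j : C n →ₗ[ℂ] ℂ) with hd
  set u : C n := ∑ j, (v (e (Sum.inl j)) * Complex.I - v (e (Sum.inr j))) •
    (EuclideanSpace.single j 1 : C n) with hu
  have hdu : d u = ((QuadraticMap.weightedSumSquares ℝ (fun _ : Fin m => (-1 : ℝ)) v : ℝ) : ℂ) := by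
    have hui : ∀ i, u i = v (e (Sum.inl i)) * Complex.I - v (e (Sum.inr i)) := by
      intro i
      simp [hu, Finset.sum_apply, Pi.single_apply]
    rw [QuadraticMap.weightedSumSquares_apply, ← e.sum_comp, Fintype.sum_sum_type,
      ← Finset.sum_add_distrib]
    simp only [hd, LinearMap.sum_apply, LinearMap.smul_apply, PiLp.projₗ_apply, hui]
    push_cast
    refine Finset.sum_congr rfl fun j _ => ?_
    simp only [smul_eq_mul]
    push_cast
    linear_combination ((v (e (Sum.inl j)) : ℂ) ^ 2) * Complex.I_sq
  refine LinearMap.ext fun x => ?_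
  have h1 := CliffordAlgebra.contractLeft_ι_mul (Q := (0 : QuadraticForm ℂ (C n))) d u x
  have h2 := CliffordAlgebra.contractLeft_contractLeft (Q := (0 : QuadraticForm ℂ (C n))) d x
  have h3 : ExteriorAlgebra.ι ℂ u * (ExteriorAlgebra.ι ℂ u * x) = 0 := by
    rw [← mul_assoc, ExteriorAlgebra.ι_sq_zero, zero_mul]
  have h4 : algebraMap ℝ (Module.End ℂ (Ext n))
      (QuadraticMap.weightedSumSquares ℝ (fun _ : Fin m => (-1 : ℝ)) v) x = d u • x := by
    rw [hdu]
    rfl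
  rw [h4, Module.End.mul_apply, LinearMap.add_apply, LinearMap.add_apply, map_add, map_add, h2]
  simp only [LinearMap.mulLeft_apply, h3]
  change 0 + CliffordAlgebra.contractLeft d
    (CliffordAlgebra.ι (0 : QuadraticForm ℂ (C n)) u * x) + _ = _
  rw [h1]
  change 0 + (_ - ExteriorAlgebra.ι ℂ u * CliffordAlgebra.contractLeft d x) + _ = _
  abel

/-- The `Cliff m`-module structure on `Λℂⁿ`, `m = 2n`. -/
def cliffAction {n m : ℕ} (e : Fin n ⊕ Fin n ≃ Fin m) :
    Cliff m →ₐ[ℝ] Module.End ℂ (Ext n) :=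
  CliffordAlgebra.lift _ ⟨gamma e, gamma_mul_self e⟩

lemma inner_gamma_left {n m : ℕ} (e : Fin n ⊕ Fin n ≃ Fin m) (v : Fin m → ℝ) (x y : Ext n) :
    ⟪gamma e v x, y⟫_ℂ = -⟪x, gamma e v y⟫_ℂ := by
  rw [gamma_apply]
  simp only [LinearMap.sum_apply, LinearMap.add_apply, LinearMap.smul_apply, sum_inner, inner_sum,
    ← Finset.sum_neg_distrib]
  refine Finset.sum_congr rfl fun j _ => ?_
  simp only [phi, piOp, LinearMap.smul_apply, LinearMap.add_apply, LinearMap.sub_apply,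
    inner_add_left, inner_add_right, inner_smul_left, inner_smul_right, inner_sub_left,
    inner_sub_right, inner_annihilation_left, inner_creation_left, Complex.conj_I,
    Complex.conj_ofReal]
  ring

lemma inner_cliffAction_left {n m : ℕ} (e : Fin n ⊕ Fin n ≃ Fin m) (a : Cliff m) (x y : Ext n) :
    ⟪cliffAction e a x, y⟫_ℂ = ⟪x, cliffAction e (star a) y⟫_ℂ := by
  induction a using CliffordAlgebra.induction generalizing x y with
  | algebraMap r =>
    rw [CliffordAlgebra.star_algebraMap, AlgHom.commutes]
    change ⟪(r : ℂ) • x, y⟫_ℂ = ⟪x, (r : ℂ) • y⟫_ℂ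
    rw [inner_smul_left, inner_smul_right, Complex.conj_ofReal]
  | ι v =>
    rw [CliffordAlgebra.star_ι, map_neg, cliffAction, CliffordAlgebra.lift_ι_apply,
      LinearMap.neg_apply, inner_neg_right]
    exact inner_gamma_left e v x y
  | mul a b ha hb =>
    rw [star_mul, map_mul, map_mul, Module.End.mul_apply, Module.End.mul_apply, ha, hb]
  | add a b ha hb =>
    rw [star_add, map_add, map_add, LinearMap.add_apply, LinearMap.add_apply, inner_add_left,
      inner_add_right, ha, hb]

/-- The Dirac spinor representation of `Spin(m)`, `m = 2n`, on `Λℂⁿ`: the restriction to `Spin(m)`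
of the action of the Clifford algebra. -/
def diracRep {n m : ℕ} (e : Fin n ⊕ Fin n ≃ Fin m) : Spin m →* U (Ext n) where
  toFun g :=
    { toLinearEquiv := LinearEquiv.ofLinearMap (cliffAction e g.1) (cliffAction e (star g.1))
        (by
          have := congrArg (cliffAction e) (spinGroup.mul_star_self_of_mem g.2)
          rwa [map_mul, map_one] at this)
        (by
          have := congrArg (cliffAction e) (spinGroup.star_mul_self_of_mem g.2)
          rwa [map_mul, map_one] at this)
      norm_map' := fun x => by
        have h : ⟪cliffAction e g.1 x, cliffAction e g.1 x⟫_ℂ = ⟪x, x⟫_ℂ := by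
          rw [inner_cliffAction_left, ← Module.End.mul_apply, ← map_mul,
            spinGroup.star_mul_self_of_mem g.2, map_one, Module.End.one_apply]
        change ‖cliffAction e g.1 x‖ = ‖x‖
        rw [@norm_eq_sqrt_re_inner ℂ, @norm_eq_sqrt_re_inner ℂ _ _ _ _ x, h] }
  map_one' := by
    ext1 x
    change cliffAction e 1 x = x
    rw [map_one, Module.End.one_apply]
  map_mul' g h := by
    ext1 x
    change cliffAction e (g.1 * h.1) x = cliffAction e g.1 (cliffAction e h.1 x)
    rw [map_mul, Module.End.mul_apply]

lemma diracRep_apply {n m : ℕ} (e : Fin n ⊕ Fin n ≃ Fin m) (g : Spin m) (x : Ext n) :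
    diracRep e g x = cliffAction e g.1 x := rfl

/-- The tensor product of the Dirac spinor representations of `Spin(4)` and `Spin(6)`, a
representation of `Spin(4) × Spin(6)` on `Λℂ² ⊗ Λℂ³`. -/
def spinorTensorRep (e₄ : Fin 2 ⊕ Fin 2 ≃ Fin 4) (e₆ : Fin 3 ⊕ Fin 3 ≃ Fin 6) :
    Spin 4 × Spin 6 →* U (Ext 2 ⊗[ℂ] Ext 3) :=
  tensorU.comp ((diracRep e₄).prodMap (diracRep e₆))

/-! ### The embeddings of the groups in real algebras -/

/-- The inclusion of `SU(2) × SU(2) × SU(4)` in a product of matrix algebras. -/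
def suIncl (g : SU 2 × SU 2 × SU 4) :
    Matrix (Fin 2) (Fin 2) ℂ × Matrix (Fin 2) (Fin 2) ℂ × Matrix (Fin 4) (Fin 4) ℂ :=
  (g.1.1, g.2.1.1, g.2.2.1)

/-- The inclusion of `Spin(4) × Spin(6)` in a product of Clifford algebras. -/
def spinIncl (g : Spin 4 × Spin 6) : Cliff 4 × Cliff 6 := (g.1.1, g.2.1)

end PatiSalam

end

open scoped ContDiff TensorProduct InnerProductSpace

noncomputable section

namespace PatiSalam

/-! ### Creation and annihilation operators generate all operators -/

/-! The theorem is an equality of matrices. Orthonormal bases `spinorBasis₂` and `spinorBasis₃` of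
the two exterior algebras, even vectors first, are chosen so that elements of the spin groups act by
block diagonal matrices equal to those of the Pati–Salam representation in `isospinBasis` and
`colorBasis`. The operator `k` matches the bases, and `α` is the inverse of reading off the blocks.

On `Λℂ²` a vector of `ℝ⁴` acts off-diagonally by a quaternion `V` and by `-V*`, so even elements act
as `diag(P, Q)` with `P`, `Q` quaternions; unit quaternions are exactly `SU(2)`. On `Λℂ³` a vector
of `ℝ⁶` acts by an antisymmetric matrix `A` and its complex conjugate, where the Hodge dual of `A`
is its conjugate; so even elements act as the diagonal blocks `P` and conjugate of `P`, which is
where `ℂ⁴ ⊕ ℂ⁴*` comes from. Congruence by `N` multiplies the Hodge pairing by `det N`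
(`transpose_mul_hodge_mul`), so a unitary `P` preserves the real form `ℝ⁶` when `det P = 1`, and
preserving it forces `det P = 1`.

Injectivity and surjectivity onto the special unitary groups rest on two facts. The complexified
Clifford algebra acts on `Λℂⁿ` as the full operator algebra, faithfully
(`exists_cliffAction_add_I_smul`, `cliffAction_add_I_smul_injective`); comparison of real structures
then realises each admissible block matrix by a real even element. And an even unitary element that
preserves the space of vectors lies in the spin group (`mem_spinGroup_of_conj`), by Cartan–Dieudonné
and a Schur argument. Smoothness is automatic: reading off blocks is linear and injective on the
even subalgebra, so both directions are restrictions of linear maps. -/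

lemma annihilation_creation_self {n : ℕ} (j : Fin n) (x : Ext n) :
    annihilation j (creation j x) = x - creation j (annihilation j x) := by
  have := CliffordAlgebra.contractLeft_ι_mul (Q := (0 : QuadraticForm ℂ (C n)))
    (EuclideanSpace.projₗ j) (EuclideanSpace.single j (1 : ℂ)) x
  refine this.trans ?_
  simp
  rfl

lemma annihilation_creation_of_ne {n : ℕ} {i j : Fin n} (h : i ≠ j) (x : Ext n) :
    annihilation i (creation j x) = -creation j (annihilation i x) := by
  have := CliffordAlgebra.contractLeft_ι_mul (Q := (0 : QuadraticForm ℂ (C n)))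
    (EuclideanSpace.projₗ i) (EuclideanSpace.single j (1 : ℂ)) x
  refine this.trans ?_
  simp [h]
  rfl

lemma annihilation_one {n : ℕ} (j : Fin n) : annihilation j (1 : Ext n) = 0 :=
  CliffordAlgebra.contractLeft_one ..

lemma creation_creation_self {n : ℕ} (j : Fin n) (x : Ext n) : creation j (creation j x) = 0 := by
  change ExteriorAlgebra.ι ℂ _ * (ExteriorAlgebra.ι ℂ _ * x) = 0
  rw [← mul_assoc, ExteriorAlgebra.ι_sq_zero, zero_mul]

lemma extBasis_empty (n : ℕ) : extBasis n ∅ = 1 := by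
  rw [extBasis, ExteriorAlgebra.basis_apply_ofCard _ Finset.card_empty]
  exact (ExteriorAlgebra.ιMulti_apply _).trans (by simp)

lemma inner_one_one (n : ℕ) : ⟪(1 : Ext n), 1⟫_ℂ = 1 := by
  rw [← extBasis_empty, inner_extBasis, if_pos rfl]

lemma inner_one_creation {n : ℕ} (j : Fin n) (x : Ext n) : ⟪(1 : Ext n), creation j x⟫_ℂ = 0 := by
  rw [← inner_annihilation_left, annihilation_one, inner_zero_left]

lemma annihilation_creation_extBasis {n : ℕ} (j : Fin n) (S : Finset (Fin n)) :
    annihilation j (creation j (extBasis n S)) = if j ∈ S then 0 else extBasis n S := by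
  split_ifs with h
  · rw [creation_of_mem j S h, map_zero]
  · rw [annihilation_creation_self, annihilation_extBasis j S h, map_zero, sub_zero]

/-- Each factor is the projection onto the span of the basis vectors that do not contain `e_j`. With
all indices in `l`, only the vacuum `1` survives. -/
lemma prod_annihilation_creation_extBasis {n : ℕ} (l : List (Fin n)) (S : Finset (Fin n)) :
    (l.map fun j => annihilation j * creation j).prod (extBasis n S) =
      if ∃ j ∈ l, j ∈ S then 0 else extBasis n S := by
  induction l with
  | nil => simp
  | cons j l ih =>
    rw [List.map_cons, List.prod_cons, Module.End.mul_apply, ih, Module.End.mul_apply]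
    by_cases hl : ∃ j ∈ l, j ∈ S
    · rw [if_pos hl, map_zero, map_zero, if_pos]
      obtain ⟨i, hi, hS⟩ := hl
      exact ⟨i, by simp [hi], hS⟩
    · rw [if_neg hl, annihilation_creation_extBasis]
      congr 1
      simp only [List.mem_cons, exists_eq_or_imp, hl, or_false]

/-- The `e_j` generate the exterior algebra, so wedging with `x` is a polynomial in the creation
operators. -/
lemma mulLeft_mem_of_creation_mem {n : ℕ} {A : Subalgebra ℂ (Module.End ℂ (Ext n))}
    (hc : ∀ j, creation j ∈ A) (x : Ext n) : LinearMap.mulLeft ℂ x ∈ A := by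
  induction x using ExteriorAlgebra.induction with
  | algebraMap r =>
    have : LinearMap.mulLeft ℂ (algebraMap ℂ (Ext n) r) = algebraMap ℂ _ r := by
      refine LinearMap.ext fun y => ?_
      exact (Algebra.smul_def r y).symm
    rw [this]
    exact A.algebraMap_mem r
  | ι v =>
    have : LinearMap.mulLeft ℂ (ExteriorAlgebra.ι ℂ v) = ∑ j, v j • creation j := by
      have hv : v = ∑ j, v j • EuclideanSpace.single j (1 : ℂ) := by
        simpa using ((EuclideanSpace.basisFun (Fin n) ℂ).sum_repr v).symm
      refine LinearMap.ext fun y => ?_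
      conv_lhs => rw [hv]
      simp [creation, Finset.sum_mul]
    rw [this]
    exact A.sum_mem fun j _ => A.smul_mem (hc j) _
  | mul x y hx hy =>
    rw [LinearMap.mulLeft_mul]
    exact A.mul_mem hx hy
  | add x y hx hy =>
    have : LinearMap.mulLeft ℂ (x + y) = LinearMap.mulLeft ℂ x + LinearMap.mulLeft ℂ y := by
      refine LinearMap.ext fun z => ?_
      exact add_mul x y z
    rw [this]
    exact A.add_mem hx hy

/-- Taking adjoints of a polynomial in creation operators reverses products, conjugates coefficients
and yields a polynomial in annihilation operators. -/
lemma exists_adjoint_mulLeft_mem {n : ℕ} {A : Subalgebra ℂ (Module.End ℂ (Ext n))}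
    (ha : ∀ j, annihilation j ∈ A) (x : Ext n) :
    ∃ D ∈ A, ∀ y z : Ext n, ⟪x * y, z⟫_ℂ = ⟪y, D z⟫_ℂ := by
  induction x using ExteriorAlgebra.induction with
  | algebraMap r =>
    refine ⟨algebraMap ℂ _ (star r), A.algebraMap_mem _, fun y z => ?_⟩
    rw [← Algebra.smul_def, inner_smul_left, Module.algebraMap_end_apply, inner_smul_right]
    rfl
  | ι v =>
    refine ⟨∑ j, star (v j) • annihilation j, A.sum_mem fun j _ => A.smul_mem (ha j) _,
      fun y z => ?_⟩
    have hv : v = ∑ j, v j • EuclideanSpace.single j (1 : ℂ) := by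
      simpa using ((EuclideanSpace.basisFun (Fin n) ℂ).sum_repr v).symm
    have : ExteriorAlgebra.ι ℂ v * y = ∑ j, v j • creation j y := by
      conv_lhs => rw [hv]
      simp [creation, Finset.sum_mul]
    rw [this]
    simp [inner_creation_left, mul_comm]
  | mul x y hx hy =>
    obtain ⟨D, hD, hx⟩ := hx
    obtain ⟨E, hE, hy⟩ := hy
    exact ⟨E * D, A.mul_mem hE hD, fun u v => by
      rw [mul_assoc, hx, hy, Module.End.mul_apply]⟩
  | add x y hx hy =>
    obtain ⟨D, hD, hx⟩ := hx
    obtain ⟨E, hE, hy⟩ := hy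
    exact ⟨D + E, A.add_mem hD hE, fun u v => by
      rw [add_mul, inner_add_left, hx, hy, LinearMap.add_apply, inner_add_right]⟩

/-- The creation and annihilation operators generate the algebra of all operators on `Λℂⁿ`. -/
lemma eq_top_of_creation_mem_of_annihilation_mem {n : ℕ} {A : Subalgebra ℂ (Module.End ℂ (Ext n))}
    (hc : ∀ j, creation j ∈ A) (ha : ∀ j, annihilation j ∈ A) : A = ⊤ := by
  -- The projection onto the vacuum line, the one rank-one operator from which all others are built.
  set P : Module.End ℂ (Ext n) :=
    ((List.finRange n).map fun j => annihilation j * creation j).prod with hP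
  have hPA : P ∈ A := by
    refine A.list_prod_mem fun X hX => ?_
    obtain ⟨j, -, rfl⟩ := List.mem_map.1 hX
    exact A.mul_mem (ha j) (hc j)
  have hPx (x : Ext n) : P x = ⟪(1 : Ext n), x⟫_ℂ • 1 := by
    have : P = ((innerSL ℂ (1 : Ext n)).toLinearMap).smulRight 1 := by
      refine (extBasis n).ext fun S => ?_
      rw [hP, prod_annihilation_creation_extBasis]
      change _ = ⟪(1 : Ext n), extBasis n S⟫_ℂ • (1 : Ext n)
      rw [← extBasis_empty, inner_extBasis]
      rcases S.eq_empty_or_nonempty with rfl | ⟨j, hj⟩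
      · simp
      · rw [if_pos ⟨j, List.mem_finRange j, hj⟩, if_neg, zero_smul]
        rintro rfl
        exact Finset.notMem_empty j hj
    rw [this]
    rfl
  refine eq_top_iff.2 fun X _ => ?_
  choose D hDA hD using exists_adjoint_mulLeft_mem ha
  -- Each summand is the rank-one operator `y ↦ ⟪e_S, y⟫ X e_S`: the vacuum component of `D e_S y`
  -- is `⟪e_S, y⟫`, and wedging the vacuum with `X e_S` gives `X e_S`.
  have : X = ∑ S, LinearMap.mulLeft ℂ (X (extBasis n S)) * (P * D (extBasis n S)) := by
    refine (extBasis n).ext fun T => ?_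
    simp only [LinearMap.sum_apply, Module.End.mul_apply, hPx, ← hD, mul_one, map_smul,
      LinearMap.mulLeft_apply, inner_extBasis]
    simp
  rw [this]
  exact A.sum_mem fun S _ => A.mul_mem (mulLeft_mem_of_creation_mem hc _)
    (A.mul_mem hPA (hDA _))

/-! ### The complexification of the Clifford algebra -/

lemma finrank_cliff (m : ℕ) : Module.finrank ℝ (Cliff m) = 2 ^ m := by
  have : Invertible (2 : ℝ) := invertibleOfNonzero two_ne_zero
  rw [(CliffordAlgebra.equivExterior
    (QuadraticMap.weightedSumSquares ℝ fun _ : Fin m => (-1 : ℝ))).finrank_eq,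
    Module.finrank_eq_card_basis (Pi.basisFun ℝ (Fin m)).ExteriorAlgebra]
  simp

lemma finrank_ext (n : ℕ) : Module.finrank ℂ (Ext n) = 2 ^ n := by
  rw [Module.finrank_eq_card_basis (extBasis n)]
  simp

instance (n : ℕ) : Module.Finite ℂ (Ext n) := Module.Finite.of_basis (extBasis n)

lemma gamma_single_inl {n m : ℕ} (e : Fin n ⊕ Fin n ≃ Fin m) (j : Fin n) :
    gamma e (Pi.single (e (Sum.inl j)) 1) = phi j := by
  rw [gamma_apply, Finset.sum_eq_single j]
  · simp
  · intro i _ hij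
    simp [hij]
  · simp

lemma gamma_single_inr {n m : ℕ} (e : Fin n ⊕ Fin n ≃ Fin m) (j : Fin n) :
    gamma e (Pi.single (e (Sum.inr j)) 1) = piOp j := by
  rw [gamma_apply, Finset.sum_eq_single j]
  · simp
  · intro i _ hij
    simp [hij]
  · simp

/-- The complex span of the Clifford action is a complex subalgebra containing all `φ_j` and `π_j`,
hence all `a_j` and `a_j^*`, which generate every operator. -/
lemma exists_cliffAction_add_I_smul {n m : ℕ} (e : Fin n ⊕ Fin n ≃ Fin m)
    (X : Module.End ℂ (Ext n)) :
    ∃ x y : Cliff m, cliffAction e x + Complex.I • cliffAction e y = X := by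
  let A : Subalgebra ℂ (Module.End ℂ (Ext n)) :=
    { carrier := {X | ∃ x y : Cliff m, cliffAction e x + Complex.I • cliffAction e y = X}
      mul_mem' := by
        rintro _ _ ⟨x, y, rfl⟩ ⟨z, w, rfl⟩
        refine ⟨x * z - y * w, x * w + y * z, ?_⟩
        simp only [map_sub, map_add, map_mul, add_mul, mul_add, smul_mul_assoc, mul_smul_comm,
          smul_smul, Complex.I_mul_I, neg_smul, one_smul, smul_add]
        abel
      add_mem' := by
        rintro _ _ ⟨x, y, rfl⟩ ⟨z, w, rfl⟩
        refine ⟨x + z, y + w, ?_⟩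
        rw [map_add, map_add, smul_add]
        abel
      algebraMap_mem' := fun c => by
        refine ⟨algebraMap ℝ _ c.re, algebraMap ℝ _ c.im, ?_⟩
        rw [AlgHom.commutes, AlgHom.commutes]
        refine LinearMap.ext fun x => ?_
        change (c.re : ℂ) • x + Complex.I • (c.im : ℂ) • x = c • x
        rw [smul_smul, ← add_smul, mul_comm, Complex.re_add_im] }
  have hγ (v : Fin m → ℝ) : gamma e v ∈ A :=
    ⟨CliffordAlgebra.ι _ v, 0, by
      rw [map_zero, smul_zero, add_zero, cliffAction, CliffordAlgebra.lift_ι_apply]⟩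
  have h1 (j : Fin n) : phi j ∈ A := gamma_single_inl e j ▸ hγ _
  have h2 (j : Fin n) : piOp j ∈ A := gamma_single_inr e j ▸ hγ _
  have hA : A = ⊤ := by
    refine eq_top_of_creation_mem_of_annihilation_mem (fun j => ?_) fun j => ?_
    · have : (creation j : Module.End ℂ (Ext n)) =
          (-Complex.I / 2) • phi j + (-1 / 2 : ℂ) • piOp j := by
        rw [phi, piOp, smul_smul, div_mul_eq_mul_div, neg_mul, Complex.I_mul_I]
        module
      rw [this]
      exact A.add_mem (A.smul_mem (h1 j) _) (A.smul_mem (h2 j) _)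
    · have : (annihilation j : Module.End ℂ (Ext n)) =
          (-Complex.I / 2) • phi j + (1 / 2 : ℂ) • piOp j := by
        rw [phi, piOp, smul_smul, div_mul_eq_mul_div, neg_mul, Complex.I_mul_I]
        module
      rw [this]
      exact A.add_mem (A.smul_mem (h1 j) _) (A.smul_mem (h2 j) _)
  have : X ∈ A := hA ▸ Algebra.mem_top
  exact this

lemma eq_of_fin_equiv {n m : ℕ} (e : Fin n ⊕ Fin n ≃ Fin m) : m = 2 * n := by
  have := Fintype.card_congr e
  simp at this
  omega

/-- The complexification of the Clifford algebra of `ℝ²ⁿ` acts faithfully on `Λℂⁿ`. -/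
lemma cliffAction_add_I_smul_injective {n m : ℕ} (e : Fin n ⊕ Fin n ≃ Fin m) {x y : Cliff m}
    (h : cliffAction e x + Complex.I • cliffAction e y = 0) : x = 0 ∧ y = 0 := by
  let f : Cliff m × Cliff m →ₗ[ℝ] Module.End ℂ (Ext n) :=
    LinearMap.coprod (cliffAction e).toLinearMap
      ((LinearMap.lsmul ℂ (Module.End ℂ (Ext n)) Complex.I).restrictScalars ℝ ∘ₗ
        (cliffAction e).toLinearMap)
  have hs : Function.Surjective f := fun X => by
    obtain ⟨x, y, hxy⟩ := exists_cliffAction_add_I_smul e X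
    exact ⟨(x, y), hxy⟩
  have : Module.Finite ℝ (Module.End ℂ (Ext n)) := Module.Finite.trans ℂ _
  -- Both real dimensions are `2 ^ (2n + 1)`, so surjectivity forces injectivity.
  have hd : Module.finrank ℝ (Cliff m × Cliff m) = Module.finrank ℝ (Module.End ℂ (Ext n)) := by
    rw [Module.finrank_prod, finrank_cliff, ← Module.finrank_mul_finrank ℝ ℂ,
      Complex.finrank_real_complex, Module.finrank_linearMap, finrank_ext, eq_of_fin_equiv e,
      two_mul n, pow_add]
    ring
  have hi := (LinearMap.injective_iff_surjective_of_finrank_eq_finrank hd).2 hs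
  have := @hi (x, y) 0 (by rw [map_zero]; exact h)
  exact Prod.mk_eq_zero.1 this

/-! ### A criterion for membership in the spin group -/

/-- The quadratic form `v ↦ -‖v‖²`. -/
abbrev negForm (m : ℕ) : QuadraticForm ℝ (Fin m → ℝ) :=
  QuadraticMap.weightedSumSquares ℝ fun _ : Fin m => (-1 : ℝ)

lemma cliffAction_ι {n m : ℕ} (e : Fin n ⊕ Fin n ≃ Fin m) (v : Fin m → ℝ) :
    cliffAction e (CliffordAlgebra.ι (negForm m) v) = gamma e v :=
  CliffordAlgebra.lift_ι_apply ..

lemma cliffAction_injective {n m : ℕ} (e : Fin n ⊕ Fin n ≃ Fin m) :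
    Function.Injective (cliffAction e) := fun x y h => by
  have := (cliffAction_add_I_smul_injective e (x := x - y) (y := 0)
    (by rw [map_sub, h, sub_self, map_zero, smul_zero, add_zero])).1
  exact sub_eq_zero.1 this

/-- Schur's lemma for the spinor module: the complex span of the Clifford action is everything, so
`Y` is central in a matrix algebra. -/
lemma exists_eq_smul_one_of_commute_gamma {n m : ℕ} (e : Fin n ⊕ Fin n ≃ Fin m)
    {Y : Module.End ℂ (Ext n)} (h : ∀ v, Y * gamma e v = gamma e v * Y) : ∃ c : ℂ, Y = c • 1 := by
  have h1 (x : Cliff m) : Y * cliffAction e x = cliffAction e x * Y := by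
    induction x using CliffordAlgebra.induction with
    | algebraMap r => rw [AlgHom.commutes, Algebra.commutes]
    | ι v => rw [cliffAction_ι, h]
    | mul a b ha hb => rw [map_mul, ← mul_assoc, ha, mul_assoc, hb, mul_assoc]
    | add a b ha hb => rw [map_add, mul_add, add_mul, ha, hb]
  have h2 : Y ∈ Subalgebra.center ℂ (Module.End ℂ (Ext n)) := by
    rw [Subalgebra.mem_center_iff]
    intro X
    obtain ⟨x, y, rfl⟩ := exists_cliffAction_add_I_smul e X
    rw [add_mul, mul_add, h1, smul_mul_assoc, mul_smul_comm, h1]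
  rw [Algebra.IsCentral.center_eq_bot, Algebra.mem_bot] at h2
  obtain ⟨c, rfl⟩ := h2
  exact ⟨c, Algebra.algebraMap_eq_smul_one c⟩

lemma exists_eq_algebraMap_of_commute_ι {n m : ℕ} (e : Fin n ⊕ Fin n ≃ Fin m) {y : Cliff m}
    (h : ∀ v, y * CliffordAlgebra.ι (negForm m) v = CliffordAlgebra.ι (negForm m) v * y) :
    ∃ r : ℝ, y = algebraMap ℝ _ r := by
  obtain ⟨c, hc⟩ := exists_eq_smul_one_of_commute_gamma e (Y := cliffAction e y) fun v => by
    rw [← cliffAction_ι, ← map_mul, h, map_mul]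
  -- The scalar `c` is complex a priori. Faithfulness of the complexification, applied to `(y - Re
  -- c) + i (-Im c)`, identifies `y` with its real part.
  refine ⟨c.re, sub_eq_zero.1
    (cliffAction_add_I_smul_injective e (y := algebraMap ℝ _ (-c.im)) ?_).1⟩
  rw [map_sub, AlgHom.commutes, AlgHom.commutes, hc]
  refine LinearMap.ext fun x => ?_
  change c • x - (c.re : ℂ) • x + Complex.I • ((-c.im : ℝ) : ℂ) • x = 0
  rw [smul_smul, ← sub_smul, ← add_smul]
  convert zero_smul ℂ x
  conv_lhs => rw [← Complex.re_add_im c]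
  simp [mul_comm]

/-! ### Parity and odd elements of the Clifford algebra -/

/-- The parity operator on `Λℂⁿ`. -/
def parity (n : ℕ) : Module.End ℂ (Ext n) :=
  (CliffordAlgebra.involute (Q := (0 : QuadraticForm ℂ (C n)))).toLinearMap

lemma parity_mul_self (n : ℕ) : parity n * parity n = 1 :=
  LinearMap.ext fun x => CliffordAlgebra.involute_involute x

lemma parity_creation {n : ℕ} (j : Fin n) :
    parity n * creation j = -(creation j * parity n) :=
  LinearMap.ext fun x => by
    change CliffordAlgebra.involute (CliffordAlgebra.ι _ _ * x) =
      -(CliffordAlgebra.ι _ _ * CliffordAlgebra.involute x)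
    rw [map_mul, CliffordAlgebra.involute_ι, neg_mul]

/-- Contraction changes the parity of the degree, hence anticommutes with the grading involution. -/
lemma involute_contractLeft {R M : Type*} [CommRing R] [AddCommGroup M] [Module R M]
    {Q : QuadraticForm R M} (d : Module.Dual R M) (x : CliffordAlgebra Q) :
    CliffordAlgebra.involute (CliffordAlgebra.contractLeft d x) =
      -CliffordAlgebra.contractLeft d (CliffordAlgebra.involute x) := by
  induction x using CliffordAlgebra.left_induction with
  | algebraMap r => simp [CliffordAlgebra.contractLeft_algebraMap]
  | add x y hx hy => rw [map_add, map_add, map_add, map_add, hx, hy, neg_add]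
  | ι_mul x v hx =>
    rw [CliffordAlgebra.contractLeft_ι_mul, map_sub, map_smul, map_mul, map_mul, hx,
      CliffordAlgebra.involute_ι, neg_mul, neg_mul, map_neg,
      CliffordAlgebra.contractLeft_ι_mul]
    simp

lemma parity_annihilation {n : ℕ} (j : Fin n) :
    parity n * annihilation j = -(annihilation j * parity n) :=
  LinearMap.ext fun x => involute_contractLeft (Q := (0 : QuadraticForm ℂ (C n))) _ x

lemma parity_gamma {n m : ℕ} (e : Fin n ⊕ Fin n ≃ Fin m) (v : Fin m → ℝ) :
    parity n * gamma e v = -(gamma e v * parity n) := by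
  rw [gamma_apply, Finset.mul_sum, Finset.sum_mul, ← Finset.sum_neg_distrib]
  refine Finset.sum_congr rfl fun j _ => ?_
  rw [phi, piOp]
  simp only [mul_add, add_mul, mul_sub, sub_mul, mul_smul_comm, smul_mul_assoc, parity_creation,
    parity_annihilation]
  module

lemma parity_cliffAction_of_mem_odd {n m : ℕ} (e : Fin n ⊕ Fin n ≃ Fin m) {y : Cliff m}
    (hy : y ∈ CliffordAlgebra.evenOdd (negForm m) 1) :
    parity n * cliffAction e y = -(cliffAction e y * parity n) := by
  induction y, hy using CliffordAlgebra.odd_induction with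
  | ι v => rw [cliffAction_ι, parity_gamma]
  | add x y _ _ hx hy => rw [map_add, mul_add, add_mul, hx, hy, neg_add]
  | ι_mul_ι_mul v w x _ hx =>
    rw [map_mul, map_mul, cliffAction_ι, cliffAction_ι, ← mul_assoc, ← mul_assoc, parity_gamma,
      neg_mul, mul_assoc _ _ (gamma e w), parity_gamma, neg_mul, mul_neg, neg_mul, neg_neg,
      ← mul_assoc, mul_assoc _ (parity n), hx, mul_neg, mul_assoc _ _ (parity n)]

/-- Composed with parity, `y` commutes with all vectors, so by Schur `y` acts as a multiple of
parity. That multiple commutes with parity, whereas an odd element anticommutes with it; hence it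
vanishes. -/
lemma eq_zero_of_mem_odd_of_anticommute_ι {n m : ℕ} (e : Fin n ⊕ Fin n ≃ Fin m) {y : Cliff m}
    (hy : y ∈ CliffordAlgebra.evenOdd (negForm m) 1)
    (h : ∀ v, y * CliffordAlgebra.ι (negForm m) v = -(CliffordAlgebra.ι (negForm m) v * y)) :
    y = 0 := by
  obtain ⟨c, hc⟩ := exists_eq_smul_one_of_commute_gamma e (Y := parity n * cliffAction e y)
    fun v => by
      rw [← cliffAction_ι, mul_assoc, ← map_mul, h, map_neg, map_mul, mul_neg, ← mul_assoc,
        cliffAction_ι, parity_gamma, neg_mul, neg_neg, mul_assoc]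
  have h1 : cliffAction e y = c • parity n := by
    rw [← one_mul (cliffAction e y), ← parity_mul_self, mul_assoc, hc, mul_smul_comm, mul_one]
  have h2 := parity_cliffAction_of_mem_odd e hy
  rw [h1, mul_smul_comm, smul_mul_assoc, parity_mul_self, ← sub_eq_zero, sub_neg_eq_add,
    ← two_smul ℂ, smul_eq_zero_iff_right two_ne_zero] at h2
  refine cliffAction_injective e ?_
  rw [h1, map_zero, ← mul_one (parity n), ← mul_smul_comm, h2, mul_zero]

/-! ### Lifting orthogonal maps to the pin group -/

lemma negForm_ofLp {m : ℕ} (w : EuclideanSpace ℝ (Fin m)) : negForm m w.ofLp = -‖w‖ ^ 2 := by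
  rw [EuclideanSpace.norm_sq_eq, QuadraticMap.weightedSumSquares_apply, ← Finset.sum_neg_distrib]
  exact Finset.sum_congr rfl fun i _ => by simp [sq]

lemma ι_mul_self_of_norm_eq_one {m : ℕ} {u : EuclideanSpace ℝ (Fin m)} (hu : ‖u‖ = 1) :
    CliffordAlgebra.ι (negForm m) u.ofLp * CliffordAlgebra.ι (negForm m) u.ofLp = -1 := by
  rw [CliffordAlgebra.ι_sq_scalar, negForm_ofLp, hu, one_pow, map_neg, map_one]

lemma ι_mem_pinGroup {m : ℕ} {u : EuclideanSpace ℝ (Fin m)} (hu : ‖u‖ = 1) :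
    CliffordAlgebra.ι (negForm m) u.ofLp ∈ pinGroup (negForm m) := by
  have h := ι_mul_self_of_norm_eq_one hu
  let x : (CliffordAlgebra (negForm m))ˣ :=
    ⟨CliffordAlgebra.ι (negForm m) u.ofLp, -CliffordAlgebra.ι (negForm m) u.ofLp,
      by rw [mul_neg, h, neg_neg],
      by rw [neg_mul, h, neg_neg]⟩
  refine ⟨⟨x, Subgroup.subset_closure ⟨_, rfl⟩, rfl⟩, ?_, ?_⟩
  · rw [CliffordAlgebra.star_ι, neg_mul, h, neg_neg]
  · rw [CliffordAlgebra.star_ι, mul_neg, h, neg_neg]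

/-- From `uw = -wu - 2⟨u, w⟩` and `u² = -1` one gets `uwu = w - 2⟨u, w⟩u`. No sign appears, because
`u⁻¹ = -u`. -/
lemma ι_mul_ι_mul_ι {m : ℕ} {u : EuclideanSpace ℝ (Fin m)} (hu : ‖u‖ = 1)
    (w : EuclideanSpace ℝ (Fin m)) :
    CliffordAlgebra.ι (negForm m) u.ofLp * CliffordAlgebra.ι (negForm m) w.ofLp *
        CliffordAlgebra.ι (negForm m) u.ofLp =
      CliffordAlgebra.ι (negForm m) ((ℝ ∙ u)ᗮ.reflection w).ofLp := by
  have hp : QuadraticMap.polar (negForm m) u.ofLp w.ofLp = -(2 * ⟪u, w⟫_ℝ) := by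
    rw [QuadraticMap.polar, QuadraticMap.weightedSumSquares_apply,
      QuadraticMap.weightedSumSquares_apply, QuadraticMap.weightedSumSquares_apply,
      ← Finset.sum_sub_distrib, ← Finset.sum_sub_distrib, PiLp.inner_apply, Finset.mul_sum,
      ← Finset.sum_neg_distrib]
    refine Finset.sum_congr rfl fun i _ => ?_
    simp
    ring
  have h := CliffordAlgebra.ι_mul_ι_add_swap (Q := negForm m) u.ofLp w.ofLp
  rw [hp] at h
  rw [eq_sub_of_add_eq h, sub_mul, mul_assoc, ι_mul_self_of_norm_eq_one hu, ← Algebra.smul_def,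
    Submodule.reflection_orthogonal_apply, Submodule.reflection_singleton_apply, hu]
  simp only [two_smul]
  simp
  module

lemma odd_mul_even {m : ℕ} {x y : Cliff m} (hx : x ∈ CliffordAlgebra.evenOdd (negForm m) 1)
    (hy : y ∈ CliffordAlgebra.evenOdd (negForm m) 0) :
    x * y ∈ CliffordAlgebra.evenOdd (negForm m) 1 :=
  CliffordAlgebra.evenOdd_mul_le _ 1 0 (Submodule.mul_mem_mul hx hy)

lemma odd_mul_odd {m : ℕ} {x y : Cliff m} (hx : x ∈ CliffordAlgebra.evenOdd (negForm m) 1)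
    (hy : y ∈ CliffordAlgebra.evenOdd (negForm m) 1) :
    x * y ∈ CliffordAlgebra.evenOdd (negForm m) 0 :=
  CliffordAlgebra.evenOdd_mul_le _ 1 1 (Submodule.mul_mem_mul hx hy)

/-- Cartan–Dieudonné: the map is a product of reflections, and `p` is the product of the
corresponding unit vectors. As `star u = -u`, each reflection is `w ↦ -(u w star u)`, so the sign
follows the parity of `p`. -/
lemma exists_pinGroup_of_linearIsometryEquiv {m : ℕ}
    (φ : EuclideanSpace ℝ (Fin m) ≃ₗᵢ[ℝ] EuclideanSpace ℝ (Fin m)) :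
    ∃ p ∈ pinGroup (negForm m),
      (p ∈ CliffordAlgebra.evenOdd (negForm m) 0 ∧
        ∀ w, CliffordAlgebra.ι (negForm m) (φ w).ofLp =
          p * CliffordAlgebra.ι (negForm m) w.ofLp * star p) ∨
      (p ∈ CliffordAlgebra.evenOdd (negForm m) 1 ∧
        ∀ w, CliffordAlgebra.ι (negForm m) (φ w).ofLp =
          -(p * CliffordAlgebra.ι (negForm m) w.ofLp * star p)) := by
  obtain ⟨l, -, rfl⟩ := φ.reflections_generate_dim
  induction l with
  | nil =>
    refine ⟨1, one_mem _, Or.inl ⟨?_, fun w => by simp⟩⟩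
    exact CliffordAlgebra.one_le_evenOdd_zero _ (Submodule.one_le.1 le_rfl)
  | cons v l ih =>
    rw [List.map_cons, List.prod_cons]
    -- The list of reflecting vectors may contain zero, whose "reflection" is the identity and
    -- contributes no factor.
    by_cases hv : v = 0
    · subst hv
      have : (ℝ ∙ (0 : EuclideanSpace ℝ (Fin m)))ᗮ.reflection = 1 :=
        LinearIsometryEquiv.ext fun w => Submodule.reflection_mem_subspace_eq_self (by simp)
      rw [this, one_mul]
      exact ih
    obtain ⟨p, hp, h⟩ := ih
    have hu : ‖(‖v‖⁻¹ : ℝ) • v‖ = 1 := norm_smul_inv_norm hv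
    have hs : (ℝ ∙ v) = ℝ ∙ ((‖v‖⁻¹ : ℝ) • v) :=
      (Submodule.span_singleton_smul_eq (IsUnit.mk0 _ (by simpa using hv)) v).symm
    have hr : (ℝ ∙ v)ᗮ.reflection = (ℝ ∙ ((‖v‖⁻¹ : ℝ) • v))ᗮ.reflection := by simp only [hs]
    rw [hr]
    set u := (‖v‖⁻¹ : ℝ) • v
    have ho := CliffordAlgebra.ι_mem_evenOdd_one (negForm m) u.ofLp
    refine ⟨CliffordAlgebra.ι (negForm m) u.ofLp * p, mul_mem (ι_mem_pinGroup hu) hp, ?_⟩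
    rcases h with ⟨h0, h⟩ | ⟨h0, h⟩
    · refine Or.inr ⟨odd_mul_even ho h0, fun w => ?_⟩
      rw [LinearIsometryEquiv.coe_mul, Function.comp_apply, ← ι_mul_ι_mul_ι hu, h, star_mul,
        CliffordAlgebra.star_ι]
      simp only [mul_neg, neg_neg, mul_assoc]
    · refine Or.inl ⟨odd_mul_odd ho h0, fun w => ?_⟩
      rw [LinearIsometryEquiv.coe_mul, Function.comp_apply, ← ι_mul_ι_mul_ι hu, h, star_mul,
        CliffordAlgebra.star_ι]
      simp only [mul_neg, neg_mul, mul_assoc]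

lemma ι_negForm_injective (m : ℕ) : Function.Injective (CliffordAlgebra.ι (negForm m)) := by
  refine (injective_iff_map_eq_zero _).2 fun v hv => ?_
  have h := CliffordAlgebra.ι_sq_scalar (negForm m) v
  rw [hv, mul_zero, ← map_zero (algebraMap ℝ _)] at h
  have h2 := negForm_ofLp (WithLp.toLp 2 v)
  rw [← (algebraMap ℝ (CliffordAlgebra (negForm m))).injective h, eq_comm, neg_eq_zero,
    sq_eq_zero_iff, norm_eq_zero] at h2
  simpa using h2

/-- Squaring `x v star x` gives back the scalar `v²`, which is minus the squared norm, so
conjugation is isometric on vectors. -/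
lemma exists_linearIsometryEquiv_of_conj {m : ℕ} {x : Cliff m} (h1 : star x * x = 1)
    (h1' : x * star x = 1)
    (h2 : ∀ v, x * CliffordAlgebra.ι (negForm m) v * star x ∈
      LinearMap.range (CliffordAlgebra.ι (negForm m))) :
    ∃ φ : EuclideanSpace ℝ (Fin m) ≃ₗᵢ[ℝ] EuclideanSpace ℝ (Fin m),
      ∀ w, CliffordAlgebra.ι (negForm m) (φ w).ofLp =
        x * CliffordAlgebra.ι (negForm m) w.ofLp * star x := by
  choose T hT using h2
  let f : EuclideanSpace ℝ (Fin m) →ₗ[ℝ] EuclideanSpace ℝ (Fin m) :=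
    { toFun := fun w => WithLp.toLp 2 (T w.ofLp)
      map_add' := fun v w => by
        rw [← WithLp.toLp_add]
        refine congrArg _ (ι_negForm_injective m ?_)
        change _ = CliffordAlgebra.ι (negForm m) (T v.ofLp + T w.ofLp)
        rw [map_add, hT, hT, hT, WithLp.ofLp_toLp, map_add, mul_add, add_mul]
      map_smul' := fun r w => by
        rw [RingHom.id_apply, ← WithLp.toLp_smul]
        refine congrArg _ (ι_negForm_injective m ?_)
        change _ = CliffordAlgebra.ι (negForm m) (r • T w.ofLp)
        rw [map_smul, hT, hT, WithLp.ofLp_toLp, map_smul, mul_smul_comm, smul_mul_assoc] }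
  have hf (w : EuclideanSpace ℝ (Fin m)) : ‖f w‖ = ‖w‖ := by
    have h3 : algebraMap ℝ (CliffordAlgebra (negForm m)) (negForm m (f w).ofLp) =
        algebraMap ℝ _ (negForm m w.ofLp) := by
      rw [← CliffordAlgebra.ι_sq_scalar]
      change CliffordAlgebra.ι (negForm m) (T w.ofLp) * CliffordAlgebra.ι (negForm m) (T w.ofLp) = _
      rw [hT]
      calc _ = x * CliffordAlgebra.ι (negForm m) w.ofLp * (star x * x) *
              CliffordAlgebra.ι (negForm m) w.ofLp * star x := by simp only [mul_assoc]
        _ = x * (CliffordAlgebra.ι (negForm m) w.ofLp * CliffordAlgebra.ι (negForm m) w.ofLp) *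
              star x := by rw [h1, mul_one, mul_assoc x]
        _ = _ := by rw [CliffordAlgebra.ι_sq_scalar, ← Algebra.commutes, mul_assoc, h1', mul_one]
    have h4 := (algebraMap ℝ (CliffordAlgebra (negForm m))).injective h3
    rw [negForm_ofLp, negForm_ofLp, neg_inj] at h4
    exact (sq_eq_sq₀ (norm_nonneg _) (norm_nonneg _)).1 h4
  let g : EuclideanSpace ℝ (Fin m) →ₗᵢ[ℝ] EuclideanSpace ℝ (Fin m) := ⟨f, hf⟩
  exact ⟨g.toLinearIsometryEquiv rfl, fun w => hT w.ofLp⟩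

/-- An even unitary element of the Clifford algebra which preserves the space of vectors belongs to
the spin group. -/
lemma mem_spinGroup_of_conj {n m : ℕ} [NeZero m] (e : Fin n ⊕ Fin n ≃ Fin m) {x : Cliff m}
    (h0 : x ∈ CliffordAlgebra.evenOdd (negForm m) 0) (h1 : star x * x = 1)
    (h1' : x * star x = 1)
    (h2 : ∀ v, x * CliffordAlgebra.ι (negForm m) v * star x ∈
      LinearMap.range (CliffordAlgebra.ι (negForm m))) :
    x ∈ spinGroup (negForm m) := by
  obtain ⟨φ, hφ⟩ := exists_linearIsometryEquiv_of_conj h1 h1' h2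
  obtain ⟨p, hp, h⟩ := exists_pinGroup_of_linearIsometryEquiv φ
  have hp1 := pinGroup.star_mul_self_of_mem hp
  have hp2 := pinGroup.mul_star_self_of_mem hp
  have hx : x = p * (star p * x) := by rw [← mul_assoc, hp2, one_mul]
  refine spinGroup.mem_iff.2 ⟨?_, h0⟩
  rcases h with ⟨-, h⟩ | ⟨hpo, h⟩
  -- The elements `x` and `p` induce the same map on vectors, so `star p * x` commutes with all of
  -- them and is a real scalar; unitarity leaves only `±1`.
  · obtain ⟨r, hr⟩ := exists_eq_algebraMap_of_commute_ι e (y := star p * x) fun v => by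
      have := (hφ (WithLp.toLp 2 v)).symm.trans (h (WithLp.toLp 2 v))
      calc _ = star p * (x * CliffordAlgebra.ι (negForm m) v * star x) * x := by
            rw [mul_assoc (star p), mul_assoc (star p), mul_assoc _ (star x), h1, mul_one]
        _ = _ := by
            rw [this]
            simp only [← mul_assoc]
            rw [hp1, one_mul]
    have hr2 : r * r = 1 := by
      have : (star (star p * x)) * (star p * x) = 1 := by
        rw [star_mul, star_star, mul_assoc, ← mul_assoc p, hp2, one_mul, h1]
      rw [hr, CliffordAlgebra.star_algebraMap, ← map_mul] at this
      exact (algebraMap ℝ (CliffordAlgebra (negForm m))).injective (this.trans (map_one _).symm)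
    rcases mul_self_eq_one_iff.1 hr2 with rfl | rfl
    · rw [hx, hr, map_one, mul_one]
      exact hp
    -- The scalar `-1` is the square of a unit vector; a unit vector exists because `m ≠ 0`.
    · have hu : ‖EuclideanSpace.single (0 : Fin m) (1 : ℝ)‖ = 1 := by simp
      rw [hx, hr, map_neg, map_one, ← ι_mul_self_of_norm_eq_one hu]
      exact mul_mem hp (mul_mem (ι_mem_pinGroup hu) (ι_mem_pinGroup hu))
  -- If `p` were odd, `star p * x` would be odd and anticommute with every vector, hence vanish,
  -- although it is invertible.
  · exfalso
    have hso : star p ∈ CliffordAlgebra.evenOdd (negForm m) 1 := by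
      rw [CliffordAlgebra.star_def, CliffordAlgebra.reverse_mem_evenOdd_iff,
        CliffordAlgebra.involute_mem_evenOdd_iff]
      exact hpo
    have := eq_zero_of_mem_odd_of_anticommute_ι e (y := star p * x)
      (odd_mul_even hso h0) fun v => by
      have := (hφ (WithLp.toLp 2 v)).symm.trans (h (WithLp.toLp 2 v))
      calc _ = star p * (x * CliffordAlgebra.ι (negForm m) v * star x) * x := by
            rw [mul_assoc (star p), mul_assoc (star p), mul_assoc _ (star x), h1, mul_one]
        _ = _ := by
            rw [this]
            simp only [← mul_assoc, mul_neg, neg_mul]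
            rw [hp1, one_mul]
    rw [this, mul_zero] at hx
    rw [hx, mul_zero] at h1
    exact zero_ne_one h1

/-! ### The spinor representations in coordinates -/

section Matrices

variable {n m : ℕ} {ι : Type*} [Fintype ι] [DecidableEq ι]

/-- The action of the Clifford algebra on `Λℂⁿ` as matrices in an orthonormal basis. -/
def cliffMatrix (e : Fin n ⊕ Fin n ≃ Fin m) (b : OrthonormalBasis ι ℂ (Ext n)) :
    Cliff m →ₐ[ℝ] Matrix ι ι ℂ :=
  ((LinearMap.toMatrixAlgEquiv b.toBasis).toAlgHom.restrictScalars ℝ).comp (cliffAction e)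

lemma cliffMatrix_eq (e : Fin n ⊕ Fin n ≃ Fin m) (b : OrthonormalBasis ι ℂ (Ext n)) (x : Cliff m) :
    cliffMatrix e b x = LinearMap.toMatrixAlgEquiv b.toBasis (cliffAction e x) := rfl

lemma cliffMatrix_apply (e : Fin n ⊕ Fin n ≃ Fin m) (b : OrthonormalBasis ι ℂ (Ext n))
    (x : Cliff m) (i j : ι) : cliffMatrix e b x i j = ⟪b i, cliffAction e x (b j)⟫_ℂ := by
  rw [cliffMatrix_eq, LinearMap.toMatrixAlgEquiv_apply, OrthonormalBasis.coe_toBasis,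
    OrthonormalBasis.coe_toBasis_repr_apply, OrthonormalBasis.repr_apply_apply]

lemma cliffMatrix_star (e : Fin n ⊕ Fin n ≃ Fin m) (b : OrthonormalBasis ι ℂ (Ext n))
    (x : Cliff m) : cliffMatrix e b (star x) = star (cliffMatrix e b x) := by
  ext i j
  rw [Matrix.star_apply, cliffMatrix_apply, cliffMatrix_apply, ← inner_cliffAction_left]
  exact (inner_conj_symm _ _).symm

lemma cliffMatrix_injective (e : Fin n ⊕ Fin n ≃ Fin m) (b : OrthonormalBasis ι ℂ (Ext n)) :
    Function.Injective (cliffMatrix e b) :=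
  (LinearMap.toMatrixAlgEquiv b.toBasis).injective.comp (cliffAction_injective e)

lemma exists_cliffMatrix_add_I_smul (e : Fin n ⊕ Fin n ≃ Fin m) (b : OrthonormalBasis ι ℂ (Ext n))
    (X : Matrix ι ι ℂ) :
    ∃ x y : Cliff m, cliffMatrix e b x + Complex.I • cliffMatrix e b y = X := by
  obtain ⟨x, y, h⟩ :=
    exists_cliffAction_add_I_smul e ((LinearMap.toMatrixAlgEquiv b.toBasis).symm X)
  refine ⟨x, y, ?_⟩
  rw [cliffMatrix_eq, cliffMatrix_eq, ← map_smul, ← map_add, h, AlgEquiv.apply_symm_apply]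

/-- The complex coordinates of a vector of `ℝ²ⁿ`. -/
def zCoord (e : Fin n ⊕ Fin n ≃ Fin m) (v : Fin m → ℝ) (j : Fin n) : ℂ :=
  v (e (Sum.inr j)) + v (e (Sum.inl j)) * Complex.I

/-- The order of the basis vectors enters only through `zCoord`, so all later matrix computations
are independent of `e`. -/
lemma gamma_eq_sum (e : Fin n ⊕ Fin n ≃ Fin m) (v : Fin m → ℝ) :
    gamma e v = ∑ j, (zCoord e v j • annihilation j - star (zCoord e v j) • creation j) := by
  rw [gamma_apply]
  refine Finset.sum_congr rfl fun j _ => ?_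
  rw [phi, piOp, zCoord]
  simp only [star_add, star_mul', RCLike.star_def, Complex.conj_ofReal, Complex.conj_I]
  module

lemma exists_zCoord_eq (e : Fin n ⊕ Fin n ≃ Fin m) (z : Fin n → ℂ) : ∃ v, zCoord e v = z := by
  refine ⟨fun i => Sum.elim (fun j => (z j).im) (fun j => (z j).re) (e.symm i), ?_⟩
  ext j
  simp [zCoord, Complex.re_add_im]

lemma cliffMatrix_ι_apply (e : Fin n ⊕ Fin n ≃ Fin m) (b : OrthonormalBasis ι ℂ (Ext n))
    (v : Fin m → ℝ) (i j : ι) :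
    cliffMatrix e b (CliffordAlgebra.ι (negForm m) v) i j =
      ∑ l, (zCoord e v l * ⟪b i, annihilation l (b j)⟫_ℂ -
        star (zCoord e v l) * ⟪b i, creation l (b j)⟫_ℂ) := by
  rw [cliffMatrix_apply, cliffAction_ι, gamma_eq_sum, LinearMap.sum_apply, inner_sum]
  refine Finset.sum_congr rfl fun l _ => ?_
  rw [LinearMap.sub_apply, LinearMap.smul_apply, LinearMap.smul_apply, inner_sub_right,
    inner_smul_right, inner_smul_right]

end Matrices

/-- The vectors `1, e₁ ∧ e₂` and `e₂, e₁` of `Λℂ²`. -/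
def spinorVec₂ : Fin 2 ⊕ Fin 2 → Ext 2 :=
  Sum.elim ![1, creation 0 (creation 1 1)] ![creation 1 1, creation 0 1]

/-- The vectors `1, e₂ ∧ e₃, e₃ ∧ e₁, e₁ ∧ e₂` and `-e₁ ∧ e₂ ∧ e₃, e₁, e₂, e₃` of `Λℂ³`. -/
def spinorVec₃ : Fin 4 ⊕ Fin 4 → Ext 3 :=
  Sum.elim ![1, creation 1 (creation 2 1), creation 2 (creation 0 1), creation 0 (creation 1 1)]
    ![-creation 0 (creation 1 (creation 2 1)), creation 0 1, creation 1 1, creation 2 1]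

lemma orthonormal_spinorVec₂ : Orthonormal ℂ spinorVec₂ := by
  rw [orthonormal_iff_ite]
  rintro (i | i) (j | j) <;> fin_cases i <;> fin_cases j <;>
    simp [spinorVec₂, inner_creation_left, annihilation_creation_self, annihilation_creation_of_ne,
      annihilation_one, inner_one_creation, inner_one_one, -inner_self_eq_norm_sq_to_K]

lemma orthonormal_spinorVec₃ : Orthonormal ℂ spinorVec₃ := by
  rw [orthonormal_iff_ite]
  rintro (i | i) (j | j) <;> fin_cases i <;> fin_cases j <;>
    simp [spinorVec₃, inner_creation_left, annihilation_creation_self, annihilation_creation_of_ne,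
      annihilation_one, inner_one_creation, inner_one_one, -inner_self_eq_norm_sq_to_K]

/-- An orthonormal basis of `Λℂ²` adapted to the half-spinor decomposition. -/
def spinorBasis₂ : OrthonormalBasis (Fin 2 ⊕ Fin 2) ℂ (Ext 2) :=
  OrthonormalBasis.mk orthonormal_spinorVec₂
    (orthonormal_spinorVec₂.linearIndependent.span_eq_top_of_card_eq_finrank'
      (by rw [finrank_ext]; rfl)).ge

/-- An orthonormal basis of `Λℂ³` adapted to the half-spinor decomposition. -/
def spinorBasis₃ : OrthonormalBasis (Fin 4 ⊕ Fin 4) ℂ (Ext 3) :=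
  OrthonormalBasis.mk orthonormal_spinorVec₃
    (orthonormal_spinorVec₃.linearIndependent.span_eq_top_of_card_eq_finrank'
      (by rw [finrank_ext]; rfl)).ge

lemma coe_spinorBasis₂ : ⇑spinorBasis₂ = spinorVec₂ := OrthonormalBasis.coe_mk _ _

lemma coe_spinorBasis₃ : ⇑spinorBasis₃ = spinorVec₃ := OrthonormalBasis.coe_mk _ _

/-- The quaternion, as a complex matrix, which represents a vector of `ℝ⁴`. -/
def vecMat₂ (z : Fin 2 → ℂ) : Matrix (Fin 2) (Fin 2) ℂ :=
  !![-star (z 1), z 0; -star (z 0), -z 1]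

/-- The antisymmetric matrix which represents a vector of `ℝ⁶`. -/
def vecMat₃ (z : Fin 3 → ℂ) : Matrix (Fin 4) (Fin 4) ℂ :=
  !![0, star (z 0), star (z 1), star (z 2); -star (z 0), 0, z 2, -z 1;
    -star (z 1), -z 2, 0, z 0; -star (z 2), z 1, -z 0, 0]

lemma cliffMatrix_ι₂ {m : ℕ} (e : Fin 2 ⊕ Fin 2 ≃ Fin m) (v : Fin m → ℝ) :
    cliffMatrix e spinorBasis₂ (CliffordAlgebra.ι (negForm m) v) =
      Matrix.fromBlocks 0 (-star (vecMat₂ (zCoord e v))) (vecMat₂ (zCoord e v)) 0 := by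
  ext i j
  rw [cliffMatrix_ι_apply, coe_spinorBasis₂]
  rcases i with i | i <;> rcases j with j | j <;> fin_cases i <;> fin_cases j <;>
    simp [spinorVec₂, vecMat₂, inner_creation_left, annihilation_creation_self,
      annihilation_creation_of_ne, annihilation_one, inner_one_creation, inner_one_one,
      creation_creation_self, -inner_self_eq_norm_sq_to_K]

/-- Each matrix entry is evaluated by moving annihilation operators to the right until they reach
the vacuum. The cyclic order and the sign of the top-degree vector in `spinorVec₃` make the lower
block antisymmetric and the upper one its conjugate. -/
lemma cliffMatrix_ι₃ {m : ℕ} (e : Fin 3 ⊕ Fin 3 ≃ Fin m) (v : Fin m → ℝ) :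
    cliffMatrix e spinorBasis₃ (CliffordAlgebra.ι (negForm m) v) =
      Matrix.fromBlocks 0 ((vecMat₃ (zCoord e v)).map star) (vecMat₃ (zCoord e v)) 0 := by
  ext i j
  rw [cliffMatrix_ι_apply, coe_spinorBasis₃]
  rcases i with i | i <;> rcases j with j | j <;> fin_cases i <;> fin_cases j <;>
    simp [Fin.sum_univ_three, spinorVec₃, vecMat₃, inner_creation_left, annihilation_creation_self,
      annihilation_creation_of_ne, annihilation_one, inner_one_creation, inner_one_one,
      creation_creation_self, -inner_self_eq_norm_sq_to_K]

/-! ### The isomorphism of `Spin(6)` with `SU(4)` -/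

lemma spinGroup_conj_mem_range_ι {m : ℕ} (x : Spin m) (v : Fin m → ℝ) :
    x.1 * CliffordAlgebra.ι (negForm m) v * star x.1 ∈
      LinearMap.range (CliffordAlgebra.ι (negForm m)) :=
  have : Invertible (2 : ℝ) := invertibleOfNonzero two_ne_zero
  spinGroup.conjAct_smul_ι_mem_range_ι (x := spinGroup.toUnits x) x.2 v

lemma exists_even_add_odd {m : ℕ} (x : Cliff m) :
    ∃ y ∈ CliffordAlgebra.evenOdd (negForm m) 0, ∃ z ∈ CliffordAlgebra.evenOdd (negForm m) 1,
      y + z = x :=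
  Submodule.mem_sup.1 ((CliffordAlgebra.evenOdd_isCompl (negForm m)).sup_eq_top ▸
    Submodule.mem_top)

/-! ### Antisymmetric matrices, Hodge duality and the determinant -/

/-- The antisymmetric matrix with the given entries above the diagonal. -/
def antisym (a b c d e f : ℂ) : Matrix (Fin 4) (Fin 4) ℂ :=
  !![0, a, b, c; -a, 0, d, e; -b, -d, 0, f; -c, -e, -f, 0]

/-- The Hodge dual of an antisymmetric matrix. -/
def hodge (A : Matrix (Fin 4) (Fin 4) ℂ) : Matrix (Fin 4) (Fin 4) ℂ :=
  antisym (A 2 3) (-A 1 3) (A 1 2) (A 0 3) (-A 0 2) (A 0 1)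

lemma eq_antisym {A : Matrix (Fin 4) (Fin 4) ℂ} (h : A.transpose = -A) :
    A = antisym (A 0 1) (A 0 2) (A 0 3) (A 1 2) (A 1 3) (A 2 3) := by
  have h1 (i j) : A j i = -A i j := congrFun (congrFun h i) j
  have h2 (i) : A i i = 0 := self_eq_neg.1 (h1 i i)
  ext i j
  fin_cases i <;> fin_cases j <;> simp [antisym, h2] <;> exact h1 _ _

lemma mul_antisym_mul_transpose_apply (N : Matrix (Fin 4) (Fin 4) ℂ) (a b c d e f : ℂ)
    (i j : Fin 4) :
    (N * antisym a b c d e f * N.transpose) i j =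
      a * (N i 0 * N j 1 - N i 1 * N j 0) + b * (N i 0 * N j 2 - N i 2 * N j 0) +
      c * (N i 0 * N j 3 - N i 3 * N j 0) + d * (N i 1 * N j 2 - N i 2 * N j 1) +
      e * (N i 1 * N j 3 - N i 3 * N j 1) + f * (N i 2 * N j 3 - N i 3 * N j 2) := by
  simp [Matrix.mul_apply, Fin.sum_univ_four, antisym]
  ring

/-- Laplace expansion along the first two rows, in the same 2×2 minors that describe the action of
`N` on `Λ²ℂ⁴`. -/
lemma det_fin_four (N : Matrix (Fin 4) (Fin 4) ℂ) :
    N.det =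
      (N 0 0 * N 1 1 - N 0 1 * N 1 0) * (N 2 2 * N 3 3 - N 2 3 * N 3 2) -
      (N 0 0 * N 1 2 - N 0 2 * N 1 0) * (N 2 1 * N 3 3 - N 2 3 * N 3 1) +
      (N 0 0 * N 1 3 - N 0 3 * N 1 0) * (N 2 1 * N 3 2 - N 2 2 * N 3 1) +
      (N 0 1 * N 1 2 - N 0 2 * N 1 1) * (N 2 0 * N 3 3 - N 2 3 * N 3 0) -
      (N 0 1 * N 1 3 - N 0 3 * N 1 1) * (N 2 0 * N 3 2 - N 2 2 * N 3 0) +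
      (N 0 2 * N 1 3 - N 0 3 * N 1 2) * (N 2 0 * N 3 1 - N 2 1 * N 3 0) := by
  rw [Matrix.det_succ_row_zero]
  simp only [Matrix.det_fin_three, Fin.sum_univ_four]
  simp [Fin.succAbove]
  ring

-- The wedge pairing `Λ² × Λ² → Λ⁴` is scaled by `det N` under `N`, and the Hodge dual encodes this
-- pairing. Here it is checked entrywise as a polynomial identity in minors.
set_option maxHeartbeats 4000000 in
lemma transpose_mul_hodge_mul_antisym (N : Matrix (Fin 4) (Fin 4) ℂ) (a b c d e f : ℂ) :
    N.transpose * hodge (N * antisym a b c d e f * N.transpose) * N =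
      N.det • hodge (antisym a b c d e f) := by
  have h (i j : Fin 4) := mul_antisym_mul_transpose_apply N.transpose
    ((N * antisym a b c d e f * N.transpose) 2 3) (-(N * antisym a b c d e f * N.transpose) 1 3)
    ((N * antisym a b c d e f * N.transpose) 1 2) ((N * antisym a b c d e f * N.transpose) 0 3)
    (-(N * antisym a b c d e f * N.transpose) 0 2) ((N * antisym a b c d e f * N.transpose) 0 1) i j
  ext i j
  refine (h i j).trans ?_
  simp only [mul_antisym_mul_transpose_apply, det_fin_four, Matrix.smul_apply, smul_eq_mul,
    Matrix.transpose_apply]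
  fin_cases i <;> fin_cases j <;> simp [hodge, antisym] <;> ring

lemma transpose_vecMat₃ (z : Fin 3 → ℂ) : (vecMat₃ z).transpose = -vecMat₃ z := by
  ext i j
  fin_cases i <;> fin_cases j <;> simp [vecMat₃]

lemma hodge_vecMat₃ (z : Fin 3 → ℂ) : hodge (vecMat₃ z) = (vecMat₃ z).map star := by
  ext i j
  fin_cases i <;> fin_cases j <;> simp [hodge, antisym, vecMat₃]

lemma exists_vecMat₃_eq {A : Matrix (Fin 4) (Fin 4) ℂ} (h1 : A.transpose = -A)
    (h2 : hodge A = A.map star) : ∃ z, vecMat₃ z = A := by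
  -- The entries away from the first row are free coordinates; self-duality up to conjugation
  -- determines that row.
  refine ⟨![A 2 3, -A 1 3, A 1 2], ?_⟩
  have h01 := congrFun (congrFun h2 2) 3
  have h02 := congrFun (congrFun h2 1) 3
  have h03 := congrFun (congrFun h2 1) 2
  simp [hodge, antisym] at h01 h02 h03
  rw [neg_eq_iff_eq_neg] at h02
  rw [eq_antisym h1]
  ext i j
  fin_cases i <;> fin_cases j <;> simp [vecMat₃, antisym, h01, h02, h03]

lemma transpose_mul_hodge_mul {N A : Matrix (Fin 4) (Fin 4) ℂ} (h : A.transpose = -A) :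
    N.transpose * hodge (N * A * N.transpose) * N = N.det • hodge A := by
  rw [eq_antisym h]
  exact transpose_mul_hodge_mul_antisym ..

lemma map_star_mul {k : ℕ} (A B : Matrix (Fin k) (Fin k) ℂ) :
    (A * B).map star = A.map star * B.map star :=
  Matrix.map_mul (f := starRingEnd ℂ)

lemma map_star_transpose {k : ℕ} (A : Matrix (Fin k) (Fin k) ℂ) :
    (A.map star).transpose = star A := rfl

lemma transpose_mul_map_star {k : ℕ} {N : Matrix (Fin k) (Fin k) ℂ} (h : star N * N = 1) :
    N.transpose * N.map star = 1 := by
  have := congrArg Matrix.transpose h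
  rwa [Matrix.transpose_mul, Matrix.transpose_one, Matrix.star_eq_conjTranspose,
    Matrix.conjTranspose, Matrix.transpose_map, Matrix.transpose_transpose] at this

lemma map_star_mul_transpose {k : ℕ} {N : Matrix (Fin k) (Fin k) ℂ} (h : N * star N = 1) :
    N.map star * N.transpose = 1 := by
  have := congrArg Matrix.transpose h
  rwa [Matrix.transpose_mul, Matrix.transpose_one, Matrix.star_eq_conjTranspose,
    Matrix.conjTranspose, Matrix.transpose_map, Matrix.transpose_transpose] at this

lemma star_fromBlocks {k : ℕ} (A B C D : Matrix (Fin k) (Fin k) ℂ) :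
    star (Matrix.fromBlocks A B C D) = Matrix.fromBlocks (star A) (star C) (star B) (star D) :=
  Matrix.fromBlocks_conjTranspose A B C D

lemma star_map_star {k : ℕ} (A : Matrix (Fin k) (Fin k) ℂ) : star (A.map star) = A.transpose := by
  ext i j
  simp

lemma map_star_map_star {k : ℕ} (A : Matrix (Fin k) (Fin k) ℂ) : (A.map star).map star = A := by
  ext i j
  simp

lemma transpose_mul_mul_transpose {k : ℕ} {N A : Matrix (Fin k) (Fin k) ℂ}
    (h : A.transpose = -A) : (N * A * N.transpose).transpose = -(N * A * N.transpose) := by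
  rw [Matrix.transpose_mul, Matrix.transpose_mul, Matrix.transpose_transpose, h, Matrix.neg_mul,
    Matrix.mul_neg, Matrix.mul_assoc]

lemma det_map_star {k : ℕ} (A : Matrix (Fin k) (Fin k) ℂ) : (A.map star).det = star A.det :=
  (RingHom.map_det (starRingEnd ℂ) A).symm

/-- `SU(4)` preserves the real subspace `ℝ⁶` of `Λ²ℂ⁴`. -/
lemma exists_vecMat₃_eq_conj {N : Matrix (Fin 4) (Fin 4) ℂ} (h : star N * N = 1)
    (hd : N.det = 1) (z : Fin 3 → ℂ) : ∃ w, vecMat₃ w = N * vecMat₃ z * N.transpose := by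
  have h' : N * star N = 1 := mul_eq_one_comm.1 h
  refine exists_vecMat₃_eq (transpose_mul_mul_transpose (transpose_vecMat₃ z)) ?_
  have h1 := transpose_mul_hodge_mul (N := N) (transpose_vecMat₃ z)
  rw [hd, one_smul, hodge_vecMat₃] at h1
  rw [map_star_mul, map_star_mul, ← h1]
  change _ = _ * _ * star N
  simp only [Matrix.mul_assoc, h', Matrix.mul_one]
  simp only [← Matrix.mul_assoc, map_star_mul_transpose h', Matrix.one_mul]

/-- A single nonzero real vector with real image suffices: the Hodge identity then says that the
conjugate of `vecMat₃ z` equals `det N` times itself. -/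
lemma det_eq_one_of_vecMat₃_eq {N : Matrix (Fin 4) (Fin 4) ℂ} (h : star N * N = 1)
    {z w : Fin 3 → ℂ} (hz : vecMat₃ z ≠ 0) (hw : vecMat₃ w = N * vecMat₃ z * N.transpose) :
    N.det = 1 := by
  have h1 := transpose_mul_hodge_mul (N := N) (transpose_vecMat₃ z)
  rw [← hw, hodge_vecMat₃, hodge_vecMat₃, hw, map_star_mul, map_star_mul] at h1
  have h2 : N.transpose * (N.map star * (vecMat₃ z).map star * (N.transpose).map star) * N =
      (vecMat₃ z).map star := by
    change N.transpose * (_ * _ * star N) * N = _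
    simp only [Matrix.mul_assoc, h, Matrix.mul_one]
    rw [← Matrix.mul_assoc, transpose_mul_map_star h, Matrix.one_mul]
  rw [h2] at h1
  have h3 : (vecMat₃ z).map star ≠ 0 := fun h => hz (by
    rw [← map_star_map_star (vecMat₃ z), h]
    ext i j
    simp)
  have h4 : (N.det - 1) • (vecMat₃ z).map star = 0 := by
    rw [sub_smul, ← h1, one_smul, sub_self]
  exact sub_eq_zero.1 ((smul_eq_zero.1 h4).resolve_right h3)

section Spin6

variable {m : ℕ} (e : Fin 3 ⊕ Fin 3 ≃ Fin m)

lemma exists_cliffMatrix_even₃ {x : Cliff m} (hx : x ∈ CliffordAlgebra.evenOdd (negForm m) 0) :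
    ∃ P, cliffMatrix e spinorBasis₃ x = Matrix.fromBlocks P 0 0 (P.map star) := by
  induction x, hx using CliffordAlgebra.even_induction with
  | algebraMap r =>
    refine ⟨algebraMap ℝ _ r, ?_⟩
    rw [AlgHom.commutes]
    ext (i | i) (j | j) <;> by_cases h : i = j <;> simp [Matrix.algebraMap_matrix_apply, h]
  | add x y _ _ hx hy =>
    obtain ⟨P, hP⟩ := hx
    obtain ⟨Q, hQ⟩ := hy
    refine ⟨P + Q, ?_⟩
    rw [map_add, hP, hQ, Matrix.fromBlocks_add]
    congr 1 <;> ext <;> simp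
  | ι_mul_ι_mul v w x _ hx =>
    obtain ⟨P, hP⟩ := hx
    refine ⟨(vecMat₃ (zCoord e v)).map star * vecMat₃ (zCoord e w) * P, ?_⟩
    rw [map_mul, map_mul, hP, cliffMatrix_ι₃, cliffMatrix_ι₃, Matrix.fromBlocks_multiply,
      Matrix.fromBlocks_multiply, map_star_mul, map_star_mul, map_star_map_star]
    simp

lemma exists_cliffMatrix_odd₃ {x : Cliff m} (hx : x ∈ CliffordAlgebra.evenOdd (negForm m) 1) :
    ∃ P, cliffMatrix e spinorBasis₃ x = Matrix.fromBlocks 0 (P.map star) P 0 := by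
  induction x, hx using CliffordAlgebra.odd_induction with
  | ι v => exact ⟨_, cliffMatrix_ι₃ e v⟩
  | add x y _ _ hx hy =>
    obtain ⟨P, hP⟩ := hx
    obtain ⟨Q, hQ⟩ := hy
    refine ⟨P + Q, ?_⟩
    rw [map_add, hP, hQ, Matrix.fromBlocks_add]
    congr 1 <;> ext <;> simp
  | ι_mul_ι_mul v w x _ hx =>
    obtain ⟨P, hP⟩ := hx
    refine ⟨vecMat₃ (zCoord e v) * (vecMat₃ (zCoord e w)).map star * P, ?_⟩
    rw [map_mul, map_mul, hP, cliffMatrix_ι₃, cliffMatrix_ι₃, Matrix.fromBlocks_multiply,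
      Matrix.fromBlocks_multiply, map_star_mul, map_star_mul, map_star_map_star]
    simp

lemma eq_zero_of_add_I_mul {a b c : ℂ} (h1 : a + Complex.I * b = c)
    (h2 : star a + Complex.I * star b = star c) : b = 0 := by
  have h3 := congrArg star h2
  rw [star_add, star_mul', star_star, star_star, star_star, RCLike.star_def, Complex.conj_I] at h3
  have h4 : Complex.I * b = 0 := by linear_combination (h1 - h3) / 2
  exact (mul_eq_zero.1 h4).resolve_left Complex.I_ne_zero

/-- Write the block matrix as `x + iy` with `x`, `y` in the real algebra. Odd parts do not meet the
diagonal blocks, and conjugation compares these blocks so as to kill the even part of `y`; the even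
part of `x` remains. -/
lemma exists_even_cliffMatrix_eq₃ (P : Matrix (Fin 4) (Fin 4) ℂ) :
    ∃ x ∈ CliffordAlgebra.evenOdd (negForm m) 0,
      cliffMatrix e spinorBasis₃ x = Matrix.fromBlocks P 0 0 (P.map star) := by
  obtain ⟨x, y, h⟩ := exists_cliffMatrix_add_I_smul e spinorBasis₃
    (Matrix.fromBlocks P 0 0 (P.map star))
  obtain ⟨x₀, hx₀, x₁, hx₁, rfl⟩ := exists_even_add_odd x
  obtain ⟨y₀, hy₀, y₁, hy₁, rfl⟩ := exists_even_add_odd y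
  obtain ⟨A, hA⟩ := exists_cliffMatrix_even₃ e hx₀
  obtain ⟨B, hB⟩ := exists_cliffMatrix_odd₃ e hx₁
  obtain ⟨A', hA'⟩ := exists_cliffMatrix_even₃ e hy₀
  obtain ⟨B', hB'⟩ := exists_cliffMatrix_odd₃ e hy₁
  refine ⟨x₀, hx₀, ?_⟩
  rw [map_add, map_add, hA, hB, hA', hB', Matrix.fromBlocks_add, Matrix.fromBlocks_add,
    Matrix.fromBlocks_smul, Matrix.fromBlocks_add, Matrix.fromBlocks_inj] at h
  obtain ⟨h1, -, -, h4⟩ := h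
  simp only [add_zero] at h1 h4
  have hA0 : A' = 0 := by
    ext i j
    exact eq_zero_of_add_I_mul (congrFun (congrFun h1 i) j) (congrFun (congrFun h4 i) j)
  rw [hA0, smul_zero, add_zero] at h1
  rw [hA, h1]

lemma vecMat₃_ne_zero : vecMat₃ (fun _ => 1) ≠ 0 := fun h => by
  have := congrFun (congrFun h 0) 1
  simp [vecMat₃] at this

/-- `Spin(6)` is isomorphic to `SU(4)`. -/
lemma exists_spin6_mulEquiv [NeZero m] :
    ∃ β : Spin m ≃* SU 4, ∀ x : Spin m, cliffMatrix e spinorBasis₃ x.1 =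
      Matrix.fromBlocks (β x).1 0 0 ((β x).1.map star) := by
  choose P hP using fun x : Spin m =>
    exists_cliffMatrix_even₃ e (spinGroup.mem_iff.1 x.2).2
  have hPu (x : Spin m) : star (P x) * P x = 1 := by
    have h := congrArg (cliffMatrix e spinorBasis₃) (spinGroup.star_mul_self_of_mem x.2)
    rw [map_mul, cliffMatrix_star, hP, map_one, star_fromBlocks, Matrix.fromBlocks_multiply,
        ← Matrix.fromBlocks_one,
      Matrix.fromBlocks_inj] at h
    simpa using h.1
  have hPd (x : Spin m) : (P x).det = 1 := by
    have hu : star ((P x).map star) * (P x).map star = 1 := by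
      have := map_star_mul_transpose (mul_eq_one_comm.1 (hPu x))
      rwa [mul_eq_one_comm, ← star_map_star] at this
    -- Any nonzero test vector would do: its conjugate by `x` is again a vector, which forces the
    -- determinant of the conjugate of `P x` to be one.
    obtain ⟨v, hv⟩ := exists_zCoord_eq e fun _ => 1
    obtain ⟨w, hw⟩ := spinGroup_conj_mem_range_ι x v
    have h := congrArg (cliffMatrix e spinorBasis₃) hw
    rw [map_mul, map_mul, cliffMatrix_star, cliffMatrix_ι₃, cliffMatrix_ι₃, hP,
      star_fromBlocks, Matrix.fromBlocks_multiply,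
      Matrix.fromBlocks_multiply, Matrix.fromBlocks_inj] at h
    have h3 := h.2.2.1
    simp only [Matrix.mul_zero, Matrix.zero_mul, zero_add, add_zero] at h3
    have h4 := det_eq_one_of_vecMat₃_eq hu (hv ▸ vecMat₃_ne_zero) h3
    rw [det_map_star, star_eq_iff_star_eq, star_one] at h4
    exact h4.symm
  let f : Spin m →* SU 4 :=
    { toFun := fun x => ⟨P x, Matrix.mem_specialUnitaryGroup_iff.2
        ⟨Matrix.mem_unitaryGroup_iff'.2 (hPu x), hPd x⟩⟩
      map_one' := Subtype.ext (by
        have h := hP 1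
        rw [OneMemClass.coe_one, map_one, ← Matrix.fromBlocks_one, Matrix.fromBlocks_inj] at h
        exact h.1.symm)
      map_mul' := fun x y => Subtype.ext (by
        have h := hP (x * y)
        rw [Submonoid.coe_mul, map_mul, hP, hP, Matrix.fromBlocks_multiply,
          Matrix.fromBlocks_inj] at h
        simpa using h.1.symm) }
  refine ⟨MulEquiv.ofBijective f ⟨fun x y h => ?_, fun g => ?_⟩, hP⟩
  · have h1 : P x = P y := congrArg Subtype.val h
    refine Subtype.ext (cliffMatrix_injective e spinorBasis₃ ?_)
    rw [hP, hP, h1]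
  · obtain ⟨x, hx, hxg⟩ := exists_even_cliffMatrix_eq₃ e g.1
    obtain ⟨hg, hgd⟩ := Matrix.mem_specialUnitaryGroup_iff.1 g.2
    have hg1 := Matrix.mem_unitaryGroup_iff.1 hg
    have hg2 := Matrix.mem_unitaryGroup_iff'.1 hg
    have hN := map_star_mul_transpose hg1
    have hN' := transpose_mul_map_star hg2
    have h1 : star x * x = 1 := by
      refine cliffMatrix_injective e spinorBasis₃ ?_
      rw [map_mul, cliffMatrix_star, hxg, map_one, star_fromBlocks, Matrix.fromBlocks_multiply,
        ← Matrix.fromBlocks_one,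
        star_map_star, hg2, hN']
      simp
    have h2 : x * star x = 1 := by
      refine cliffMatrix_injective e spinorBasis₃ ?_
      rw [map_mul, map_one, mul_eq_one_comm, ← map_mul, h1, map_one]
    have h3 : x ∈ spinGroup (negForm m) := by
      refine mem_spinGroup_of_conj e hx h1 h2 fun v => ?_
      -- Conjugation by `x` acts on the lower left block, so the conjugate of `g` multiplies from
      -- the left and `star g`, the transpose of that conjugate, from the right.
      obtain ⟨w, hw⟩ := exists_vecMat₃_eq_conj (N := g.1.map star) (by rw [star_map_star, hN']) (by
        rw [det_map_star, hgd, star_one]) (zCoord e v)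
      obtain ⟨v', rfl⟩ := exists_zCoord_eq e w
      refine ⟨v', cliffMatrix_injective e spinorBasis₃ ?_⟩
      rw [map_mul, map_mul, cliffMatrix_star, cliffMatrix_ι₃, cliffMatrix_ι₃, hxg,
        star_fromBlocks, Matrix.fromBlocks_multiply,
        Matrix.fromBlocks_multiply, hw, map_star_mul, map_star_mul, map_star_map_star,
        star_map_star]
      have hs : (star g.1).map star = g.1.transpose := by
        ext i j
        simp
      rw [map_star_transpose, hs]
      simp
    refine ⟨⟨x, h3⟩, Subtype.ext ?_⟩
    have h := hP ⟨x, h3⟩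
    rw [hxg, Matrix.fromBlocks_inj] at h
    exact h.1.symm

end Spin6

/-! ### The isomorphism of `Spin(4)` with `SU(2) × SU(2)` -/

/-- A complex matrix which represents a quaternion. -/
def IsQuaternion (P : Matrix (Fin 2) (Fin 2) ℂ) : Prop :=
  P 1 1 = star (P 0 0) ∧ P 1 0 = -star (P 0 1)

namespace IsQuaternion

variable {P Q : Matrix (Fin 2) (Fin 2) ℂ}

lemma ofReal (r : ℝ) : IsQuaternion (algebraMap ℝ (Matrix (Fin 2) (Fin 2) ℂ) r) := by
  simp [IsQuaternion, Matrix.algebraMap_matrix_apply]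

lemma add (hP : IsQuaternion P) (hQ : IsQuaternion Q) : IsQuaternion (P + Q) := by
  constructor
  · simp [hP.1, hQ.1]
  · simp [hP.2, hQ.2, add_comm]

lemma mul (hP : IsQuaternion P) (hQ : IsQuaternion Q) : IsQuaternion (P * Q) := by
  constructor
  · simp [Matrix.mul_apply, Fin.sum_univ_two, hP.1, hQ.1, hP.2, hQ.2]
    ring
  · simp [Matrix.mul_apply, Fin.sum_univ_two, hP.1, hQ.1, hP.2, hQ.2]

lemma neg (hP : IsQuaternion P) : IsQuaternion (-P) := by
  constructor
  · simp [hP.1]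
  · simp [hP.2]

lemma star (hP : IsQuaternion P) : IsQuaternion (star P) := by
  constructor
  · simp [hP.1]
  · simp [hP.2]

/-- Quaternions form a real form of the 2×2 complex matrices, so quaternionic real and imaginary
parts are unique. -/
lemma eq_zero_of_add_I_smul (hP : IsQuaternion P) (hQ : IsQuaternion Q)
    {R : Matrix (Fin 2) (Fin 2) ℂ} (hR : IsQuaternion R) (h : P + Complex.I • Q = R) : Q = 0 := by
  have h' (i j) : P i j + Complex.I * Q i j = R i j := congrFun (congrFun h i) j
  have h00 : Q 0 0 = 0 := by
    refine eq_zero_of_add_I_mul (h' 0 0) ?_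
    rw [← hP.1, ← hQ.1, ← hR.1, h' 1 1]
  have h01 : Q 0 1 = 0 := by
    refine eq_zero_of_add_I_mul (h' 0 1) ?_
    have := h' 1 0
    rw [hP.2, hQ.2, hR.2] at this
    linear_combination -this
  ext i j
  fin_cases i <;> fin_cases j <;> simp [h00, h01, hQ.1, hQ.2]

/-- For a quaternion the determinant is the squared norm of its first row, a diagonal entry of `P *
star P`. -/
lemma det_eq_one (hP : IsQuaternion P) (h : P * Star.star P = 1) : P.det = 1 := by
  have := congrFun (congrFun h 0) 0
  simp [Matrix.mul_apply, Fin.sum_univ_two] at this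
  rw [Matrix.det_fin_two, hP.1, hP.2]
  simp
  linear_combination this

/-- The inverse of `P` is both its adjoint and its adjugate; equating their entries gives the
quaternion relations. -/
lemma of_specialUnitary (h : Star.star P * P = 1) (hd : P.det = 1) : IsQuaternion P := by
  have h1 : Star.star P = P.adjugate := by
    calc Star.star P = Star.star P * (P * P.adjugate) := by
          rw [Matrix.mul_adjugate, hd, one_smul, mul_one]
      _ = P.adjugate := by rw [← mul_assoc, h, one_mul]
  rw [Matrix.adjugate_fin_two] at h1
  have h2 := congrFun (congrFun h1 0) 0
  have h3 := congrFun (congrFun h1 1) 0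
  simp at h2 h3
  constructor
  · simp [h2]
  · simp [h3]

end IsQuaternion

lemma isQuaternion_vecMat₂ (z : Fin 2 → ℂ) : IsQuaternion (vecMat₂ z) := by
  simp [IsQuaternion, vecMat₂]

lemma exists_vecMat₂_eq {P : Matrix (Fin 2) (Fin 2) ℂ} (h : IsQuaternion P) :
    ∃ z, vecMat₂ z = P := by
  refine ⟨![P 0 1, -P 1 1], ?_⟩
  ext i j
  fin_cases i <;> fin_cases j <;> simp [vecMat₂, h.1, h.2]

section Spin4

variable {m : ℕ} (e : Fin 2 ⊕ Fin 2 ≃ Fin m)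

lemma exists_cliffMatrix_even₂ {x : Cliff m} (hx : x ∈ CliffordAlgebra.evenOdd (negForm m) 0) :
    ∃ P Q, IsQuaternion P ∧ IsQuaternion Q ∧
      cliffMatrix e spinorBasis₂ x = Matrix.fromBlocks P 0 0 Q := by
  induction x, hx using CliffordAlgebra.even_induction with
  | algebraMap r =>
    refine ⟨algebraMap ℝ _ r, algebraMap ℝ _ r, .ofReal r, .ofReal r, ?_⟩
    rw [AlgHom.commutes]
    ext (i | i) (j | j) <;> by_cases h : i = j <;> simp [Matrix.algebraMap_matrix_apply, h]
  | add x y _ _ hx hy =>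
    obtain ⟨P, Q, hP, hQ, h⟩ := hx
    obtain ⟨P', Q', hP', hQ', h'⟩ := hy
    refine ⟨P + P', Q + Q', hP.add hP', hQ.add hQ', ?_⟩
    rw [map_add, h, h', Matrix.fromBlocks_add, add_zero]
  | ι_mul_ι_mul v w x _ hx =>
    obtain ⟨P, Q, hP, hQ, h⟩ := hx
    refine ⟨-star (vecMat₂ (zCoord e v)) * vecMat₂ (zCoord e w) * P,
      vecMat₂ (zCoord e v) * -star (vecMat₂ (zCoord e w)) * Q,
      ((isQuaternion_vecMat₂ _).star.neg.mul (isQuaternion_vecMat₂ _)).mul hP,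
      ((isQuaternion_vecMat₂ _).mul (isQuaternion_vecMat₂ _).star.neg).mul hQ, ?_⟩
    rw [map_mul, map_mul, h, cliffMatrix_ι₂, cliffMatrix_ι₂, Matrix.fromBlocks_multiply,
      Matrix.fromBlocks_multiply]
    simp

lemma exists_cliffMatrix_odd₂ {x : Cliff m} (hx : x ∈ CliffordAlgebra.evenOdd (negForm m) 1) :
    ∃ P Q, IsQuaternion P ∧ IsQuaternion Q ∧
      cliffMatrix e spinorBasis₂ x = Matrix.fromBlocks 0 P Q 0 := by
  induction x, hx using CliffordAlgebra.odd_induction with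
  | ι v =>
    exact ⟨_, _, (isQuaternion_vecMat₂ _).star.neg, isQuaternion_vecMat₂ _, cliffMatrix_ι₂ e v⟩
  | add x y _ _ hx hy =>
    obtain ⟨P, Q, hP, hQ, h⟩ := hx
    obtain ⟨P', Q', hP', hQ', h'⟩ := hy
    refine ⟨P + P', Q + Q', hP.add hP', hQ.add hQ', ?_⟩
    rw [map_add, h, h', Matrix.fromBlocks_add, add_zero]
  | ι_mul_ι_mul v w x _ hx =>
    obtain ⟨P, Q, hP, hQ, h⟩ := hx
    refine ⟨-star (vecMat₂ (zCoord e v)) * vecMat₂ (zCoord e w) * P,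
      vecMat₂ (zCoord e v) * -star (vecMat₂ (zCoord e w)) * Q,
      ((isQuaternion_vecMat₂ _).star.neg.mul (isQuaternion_vecMat₂ _)).mul hP,
      ((isQuaternion_vecMat₂ _).mul (isQuaternion_vecMat₂ _).star.neg).mul hQ, ?_⟩
    rw [map_mul, map_mul, h, cliffMatrix_ι₂, cliffMatrix_ι₂, Matrix.fromBlocks_multiply,
      Matrix.fromBlocks_multiply]
    simp

lemma exists_even_cliffMatrix_eq₂ {P Q : Matrix (Fin 2) (Fin 2) ℂ} (hP : IsQuaternion P)
    (hQ : IsQuaternion Q) :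
    ∃ x ∈ CliffordAlgebra.evenOdd (negForm m) 0,
      cliffMatrix e spinorBasis₂ x = Matrix.fromBlocks P 0 0 Q := by
  obtain ⟨x, y, h⟩ := exists_cliffMatrix_add_I_smul e spinorBasis₂ (Matrix.fromBlocks P 0 0 Q)
  obtain ⟨x₀, hx₀, x₁, hx₁, rfl⟩ := exists_even_add_odd x
  obtain ⟨y₀, hy₀, y₁, hy₁, rfl⟩ := exists_even_add_odd y
  obtain ⟨A, B, hA, hB, hAB⟩ := exists_cliffMatrix_even₂ e hx₀
  obtain ⟨C, D, -, -, hCD⟩ := exists_cliffMatrix_odd₂ e hx₁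
  obtain ⟨A', B', hA', hB', hAB'⟩ := exists_cliffMatrix_even₂ e hy₀
  obtain ⟨C', D', -, -, hCD'⟩ := exists_cliffMatrix_odd₂ e hy₁
  refine ⟨x₀, hx₀, ?_⟩
  rw [map_add, map_add, hAB, hAB', hCD, hCD', Matrix.fromBlocks_add, Matrix.fromBlocks_add,
    Matrix.fromBlocks_smul, Matrix.fromBlocks_add, Matrix.fromBlocks_inj] at h
  obtain ⟨h1, -, -, h4⟩ := h
  simp only [add_zero] at h1 h4
  have hA0 := hA.eq_zero_of_add_I_smul hA' hP h1
  have hB0 := hB.eq_zero_of_add_I_smul hB' hQ h4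
  rw [hA0, smul_zero, add_zero] at h1
  rw [hB0, smul_zero, add_zero] at h4
  rw [hAB, h1, h4]

/-- `Spin(4)` is isomorphic to `SU(2) × SU(2)`. -/
lemma exists_spin4_mulEquiv [NeZero m] :
    ∃ β : Spin m ≃* SU 2 × SU 2, ∀ x : Spin m, cliffMatrix e spinorBasis₂ x.1 =
      Matrix.fromBlocks (β x).1.1 0 0 (β x).2.1 := by
  choose P Q hPq hQq hPQ using fun x : Spin m =>
    exists_cliffMatrix_even₂ e (spinGroup.mem_iff.1 x.2).2
  have hu (x : Spin m) : star (P x) * P x = 1 ∧ star (Q x) * Q x = 1 := by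
    have h := congrArg (cliffMatrix e spinorBasis₂) (spinGroup.star_mul_self_of_mem x.2)
    rw [map_mul, cliffMatrix_star, hPQ, map_one, star_fromBlocks, Matrix.fromBlocks_multiply,
      ← Matrix.fromBlocks_one, Matrix.fromBlocks_inj] at h
    constructor
    · simpa using h.1
    · simpa using h.2.2.2
  have hPs (x : Spin m) : P x ∈ Matrix.specialUnitaryGroup (Fin 2) ℂ :=
    Matrix.mem_specialUnitaryGroup_iff.2 ⟨Matrix.mem_unitaryGroup_iff'.2 (hu x).1,
      (hPq x).det_eq_one (mul_eq_one_comm.1 (hu x).1)⟩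
  have hQs (x : Spin m) : Q x ∈ Matrix.specialUnitaryGroup (Fin 2) ℂ :=
    Matrix.mem_specialUnitaryGroup_iff.2 ⟨Matrix.mem_unitaryGroup_iff'.2 (hu x).2,
      (hQq x).det_eq_one (mul_eq_one_comm.1 (hu x).2)⟩
  let f : Spin m →* SU 2 × SU 2 :=
    { toFun := fun x => (⟨P x, hPs x⟩, ⟨Q x, hQs x⟩)
      map_one' := by
        have h := hPQ 1
        rw [OneMemClass.coe_one, map_one, ← Matrix.fromBlocks_one, Matrix.fromBlocks_inj] at h
        exact Prod.ext (Subtype.ext h.1.symm) (Subtype.ext h.2.2.2.symm)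
      map_mul' := fun x y => by
        have h := hPQ (x * y)
        rw [Submonoid.coe_mul, map_mul, hPQ, hPQ, Matrix.fromBlocks_multiply,
          Matrix.fromBlocks_inj] at h
        exact Prod.ext (Subtype.ext (by simpa using h.1.symm))
          (Subtype.ext (by simpa using h.2.2.2.symm)) }
  refine ⟨MulEquiv.ofBijective f ⟨fun x y h => ?_, fun g => ?_⟩, hPQ⟩
  · have h1 : P x = P y := congrArg (fun p => p.1.1) h
    have h2 : Q x = Q y := congrArg (fun p => p.2.1) h
    refine Subtype.ext (cliffMatrix_injective e spinorBasis₂ ?_)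
    rw [hPQ, hPQ, h1, h2]
  · obtain ⟨⟨g, hg⟩, ⟨h, hh⟩⟩ := g
    obtain ⟨hg, hgd⟩ := Matrix.mem_specialUnitaryGroup_iff.1 hg
    obtain ⟨hh, hhd⟩ := Matrix.mem_specialUnitaryGroup_iff.1 hh
    have hg := Matrix.mem_unitaryGroup_iff'.1 hg
    have hh := Matrix.mem_unitaryGroup_iff'.1 hh
    have hgq := IsQuaternion.of_specialUnitary hg hgd
    have hhq := IsQuaternion.of_specialUnitary hh hhd
    obtain ⟨x, hx, hxg⟩ := exists_even_cliffMatrix_eq₂ e hgq hhq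
    have h1 : star x * x = 1 := by
      refine cliffMatrix_injective e spinorBasis₂ ?_
      rw [map_mul, cliffMatrix_star, hxg, map_one, star_fromBlocks, Matrix.fromBlocks_multiply,
        ← Matrix.fromBlocks_one, hg, hh]
      simp
    have h2 : x * star x = 1 := by
      refine cliffMatrix_injective e spinorBasis₂ ?_
      rw [map_mul, map_one, mul_eq_one_comm, ← map_mul, h1, map_one]
    have h3 : x ∈ spinGroup (negForm m) := by
      refine mem_spinGroup_of_conj e hx h1 h2 fun v => ?_
      -- The lower left block of the conjugated vector is `h V star g`. It is a product of
      -- quaternions, and every quaternion represents a vector of `ℝ⁴`.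
      obtain ⟨w, hw⟩ := exists_vecMat₂_eq
        ((hhq.mul (isQuaternion_vecMat₂ (zCoord e v))).mul hgq.star)
      obtain ⟨v', rfl⟩ := exists_zCoord_eq e w
      refine ⟨v', cliffMatrix_injective e spinorBasis₂ ?_⟩
      rw [map_mul, map_mul, cliffMatrix_star, cliffMatrix_ι₂, cliffMatrix_ι₂, hxg,
        star_fromBlocks, Matrix.fromBlocks_multiply, Matrix.fromBlocks_multiply, hw]
      simp [mul_assoc]
    refine ⟨⟨x, h3⟩, ?_⟩
    have h := hPQ ⟨x, h3⟩
    rw [hxg, Matrix.fromBlocks_inj] at h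
    exact Prod.ext (Subtype.ext h.1.symm) (Subtype.ext h.2.2.2.symm)

end Spin4

/-! ### Smoothness of restrictions of linear maps -/

lemma isSmooth_of_linearMap {G H V W : Type*} [AddCommGroup V] [Module ℝ V] [Module.Finite ℝ V]
    [AddCommGroup W] [Module ℝ W] [Module.Finite ℝ W] {i : G → V} {j : H → W} {f : G → H}
    (L : V →ₗ[ℝ] W) (h : ∀ g, j (f g) = L (i g)) : IsSmooth i j f := fun g => by
  let F := (coords W).toLinearMap ∘ₗ L ∘ₗ (coords V).symm.toLinearMap
  refine ⟨Set.univ, F, isOpen_univ, Set.mem_univ _, ?_, fun g' _ => ?_⟩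
  · exact (LinearMap.toContinuousLinearMap F).contDiff.contDiffOn
  · simp [F, h]

/-- A group isomorphism whose inverse is the restriction of a linear map, injective on a subspace
which contains the group, is an isomorphism of Lie groups. -/
lemma isLieGroupIso_of_linearMap {G H V W : Type*} [Group G] [Group H] [AddCommGroup V]
    [Module ℝ V] [Module.Finite ℝ V] [AddCommGroup W] [Module ℝ W] [Module.Finite ℝ W]
    {i : G → V} {j : H → W} {α : G ≃* H} (L : W →ₗ[ℝ] V) (E : Submodule ℝ W)
    (hE : ∀ h, j h ∈ E) (hL : ∀ x ∈ E, L x = 0 → x = 0) (h : ∀ x, i (α.symm x) = L (j x)) :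
    IsLieGroupIso i j α := by
  refine ⟨?_, isSmooth_of_linearMap L h⟩
  -- A linear left inverse of `L` on `E` extends `α` to a linear map on the ambient space.
  obtain ⟨K, hK⟩ := (L.domRestrict E).exists_leftInverse_of_injective
    (LinearMap.ker_eq_bot'.2 fun x hx => Subtype.ext (hL x.1 x.2 hx))
  refine isSmooth_of_linearMap (E.subtype ∘ₗ K) fun g => ?_
  have h1 := h (α g)
  rw [MulEquiv.symm_apply_apply] at h1
  have h2 := LinearMap.congr_fun hK ⟨j (α g), hE _⟩
  rw [h1]
  exact (congrArg Subtype.val h2).symm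

/-- The diagonal blocks of the spinor representations of `Spin(4)` and `Spin(6)` which determine
the others. -/
def halfSpinors {m₄ m₆ : ℕ} (e₄ : Fin 2 ⊕ Fin 2 ≃ Fin m₄) (e₆ : Fin 3 ⊕ Fin 3 ≃ Fin m₆) :
    Cliff m₄ × Cliff m₆ →ₗ[ℝ]
      Matrix (Fin 2) (Fin 2) ℂ × Matrix (Fin 2) (Fin 2) ℂ × Matrix (Fin 4) (Fin 4) ℂ where
  toFun x := ((cliffMatrix e₄ spinorBasis₂ x.1).toBlocks₁₁,
    (cliffMatrix e₄ spinorBasis₂ x.1).toBlocks₂₂, (cliffMatrix e₆ spinorBasis₃ x.2).toBlocks₁₁)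
  map_add' x y := by
    rw [Prod.fst_add, Prod.snd_add, map_add, map_add]
    rfl
  map_smul' r x := by
    rw [Prod.smul_fst, Prod.smul_snd, map_smul, map_smul]
    rfl

lemma eq_zero_of_halfSpinors_eq_zero {m₄ m₆ : ℕ} (e₄ : Fin 2 ⊕ Fin 2 ≃ Fin m₄)
    (e₆ : Fin 3 ⊕ Fin 3 ≃ Fin m₆) {x : Cliff m₄ × Cliff m₆}
    (h4 : x.1 ∈ CliffordAlgebra.evenOdd (negForm m₄) 0)
    (h6 : x.2 ∈ CliffordAlgebra.evenOdd (negForm m₆) 0) (h : halfSpinors e₄ e₆ x = 0) : x = 0 := by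
  obtain ⟨P, Q, -, -, hPQ⟩ := exists_cliffMatrix_even₂ e₄ h4
  obtain ⟨R, hR⟩ := exists_cliffMatrix_even₃ e₆ h6
  have h1 : (cliffMatrix e₄ spinorBasis₂ x.1).toBlocks₁₁ = 0 := congrArg Prod.fst h
  have h2 : (cliffMatrix e₄ spinorBasis₂ x.1).toBlocks₂₂ = 0 := congrArg (fun p => p.2.1) h
  have h3 : (cliffMatrix e₆ spinorBasis₃ x.2).toBlocks₁₁ = 0 := congrArg (fun p => p.2.2) h
  rw [hPQ, Matrix.toBlocks_fromBlocks₁₁] at h1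
  rw [hPQ, Matrix.toBlocks_fromBlocks₂₂] at h2
  rw [hR, Matrix.toBlocks_fromBlocks₁₁] at h3
  refine Prod.ext (cliffMatrix_injective e₄ spinorBasis₂ ?_)
    (cliffMatrix_injective e₆ spinorBasis₃ ?_)
  · rw [hPQ, h1, h2, Matrix.fromBlocks_zero, Prod.fst_zero, map_zero]
  · have h5 : (0 : Matrix (Fin 4) (Fin 4) ℂ).map star = 0 := by
      ext i j
      simp
    rw [hR, h3, h5, Matrix.fromBlocks_zero, Prod.snd_zero, map_zero]

/-! ### The intertwining operators -/

/-- Operators with the same matrix in two orthonormal bases are intertwined by the unitary that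
matches the bases. -/
lemma equiv_comm_of_inner_eq {ι V W : Type*} [Fintype ι] [NormedAddCommGroup V]
    [InnerProductSpace ℂ V] [NormedAddCommGroup W] [InnerProductSpace ℂ W]
    (s : OrthonormalBasis ι ℂ V) (b : OrthonormalBasis ι ℂ W) (A : U V) (B : U W)
    (h : ∀ i j, ⟪s i, A (s j)⟫_ℂ = ⟪b i, B (b j)⟫_ℂ) (x : V) :
    s.equiv b (Equiv.refl ι) (A x) = B (s.equiv b (Equiv.refl ι) x) := by
  have key : (s.equiv b (Equiv.refl ι)).toLinearEquiv.toLinearMap ∘ₗ A.toLinearEquiv.toLinearMap =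
      B.toLinearEquiv.toLinearMap ∘ₗ (s.equiv b (Equiv.refl ι)).toLinearEquiv.toLinearMap := by
    refine s.toBasis.ext fun j => b.toBasis.ext_elem fun i => ?_
    simp only [OrthonormalBasis.coe_toBasis_repr_apply, OrthonormalBasis.repr_apply_apply,
      OrthonormalBasis.coe_toBasis]
    change ⟪b i, s.equiv b (Equiv.refl ι) (A (s j))⟫_ℂ = ⟪b i, B (s.equiv b (Equiv.refl ι) (s j))⟫_ℂ
    rw [OrthonormalBasis.equiv_apply_basis, Equiv.refl_apply, ← h i j,
      ← (s.equiv b (Equiv.refl ι)).inner_map_map, OrthonormalBasis.equiv_apply_basis,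
      Equiv.refl_apply]
  exact LinearMap.congr_fun key x

lemma inner_basisFun_fund {n : ℕ} (g : SU n) (i j : Fin n) :
    ⟪EuclideanSpace.basisFun (Fin n) ℂ i, fund n g (EuclideanSpace.basisFun (Fin n) ℂ j)⟫_ℂ =
      g.1 i j := by
  rw [fund_apply]
  simp [EuclideanSpace.inner_single_left]

lemma orthonormal_toDual_basisFun (n : ℕ) :
    Orthonormal ℂ fun i =>
      InnerProductSpace.toDual ℂ (C n) (EuclideanSpace.basisFun (Fin n) ℂ i) := by
  rw [orthonormal_iff_ite]
  intro i j
  change ⟪(InnerProductSpace.toDual ℂ (C n)).symm _,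
    (InnerProductSpace.toDual ℂ (C n)).symm _⟫_ℂ = _
  rw [LinearIsometryEquiv.symm_apply_apply, LinearIsometryEquiv.symm_apply_apply,
    orthonormal_iff_ite.1 (EuclideanSpace.basisFun (Fin n) ℂ).orthonormal]
  simp only [eq_comm]

/-- The dual basis of the standard basis of `ℂⁿ`. -/
def dualBasis (n : ℕ) : OrthonormalBasis (Fin n) ℂ (StrongDual ℂ (C n)) :=
  OrthonormalBasis.mk (orthonormal_toDual_basisFun n)
    ((orthonormal_toDual_basisFun n).linearIndependent.span_eq_top_of_card_eq_finrank'
      (by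
        rw [← (LinearMap.toContinuousLinearMap (𝕜 := ℂ) (E := C n) (F' := ℂ)).finrank_eq,
          Module.finrank_linearMap, Module.finrank_self, mul_one, finrank_euclideanSpace])).ge

lemma dualBasis_apply {n : ℕ} (i : Fin n) :
    dualBasis n i = InnerProductSpace.toDual ℂ (C n) (EuclideanSpace.basisFun (Fin n) ℂ i) :=
  congrFun (OrthonormalBasis.coe_mk _ _) i

/-- The Riesz map is equivariant for unitary operators. Being antilinear, it turns the matrix of `A`
into its entrywise conjugate on the dual. -/
lemma dualU_toDual {V : Type*} [NormedAddCommGroup V] [InnerProductSpace ℂ V] [CompleteSpace V]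
    (A : U V) (w : V) :
    dualU A (InnerProductSpace.toDual ℂ V w) = InnerProductSpace.toDual ℂ V (A w) := by
  refine ContinuousLinearMap.ext fun x => ?_
  change ⟪w, A.symm x⟫_ℂ = ⟪A w, x⟫_ℂ
  rw [← A.inner_map_map, LinearIsometryEquiv.apply_symm_apply]

lemma inner_dualBasis_dualU {n : ℕ} (g : SU n) (i j : Fin n) :
    ⟪dualBasis n i, dualU (fund n g) (dualBasis n j)⟫_ℂ = star (g.1 i j) := by
  rw [dualBasis_apply, dualBasis_apply, dualU_toDual]
  change ⟪(InnerProductSpace.toDual ℂ (C n)).symm _,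
    (InnerProductSpace.toDual ℂ (C n)).symm _⟫_ℂ = _
  rw [LinearIsometryEquiv.symm_apply_apply, LinearIsometryEquiv.symm_apply_apply,
    ← inner_basisFun_fund]
  exact (inner_conj_symm _ _).symm

lemma inner_prod_directSumU {ι κ V W : Type*} [Fintype ι] [Fintype κ] [NormedAddCommGroup V]
    [InnerProductSpace ℂ V] [NormedAddCommGroup W] [InnerProductSpace ℂ W]
    (s : OrthonormalBasis ι ℂ V) (t : OrthonormalBasis κ ℂ W) (A : U V) (B : U W) (i j : ι ⊕ κ) :
    ⟪s.prod t i, directSumU (A, B) (s.prod t j)⟫_ℂ =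
      Matrix.fromBlocks (Matrix.of fun i j => ⟪s i, A (s j)⟫_ℂ) 0 0
        (Matrix.of fun i j => ⟪t i, B (t j)⟫_ℂ) i j := by
  have h (x : V) (y : W) :
      directSumU (A, B) (WithLp.toLp 2 (x, y)) = WithLp.toLp 2 (A x, B y) := rfl
  rw [OrthonormalBasis.prod_apply, OrthonormalBasis.prod_apply]
  rcases i with i | i <;> rcases j with j | j <;> simp [h]

/-- The orthonormal basis `(e₁ ⊗ 1, e₂ ⊗ 1, 1 ⊗ e₁, 1 ⊗ e₂)`. -/
def isospinBasis : OrthonormalBasis (Fin 2 ⊕ Fin 2) ℂ IsospinSpace :=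
  ((EuclideanSpace.basisFun (Fin 2) ℂ).map ((TensorProduct.commIsometry ℂ (C 2) ℂ).trans
    (TensorProduct.lidIsometry ℂ (C 2))).symm).prod
  ((EuclideanSpace.basisFun (Fin 2) ℂ).map (TensorProduct.lidIsometry ℂ (C 2)).symm)

/-- The orthonormal basis of `ℂ⁴ ⊕ ℂ⁴*` made of the standard basis and its dual basis. -/
def colorBasis : OrthonormalBasis (Fin 4 ⊕ Fin 4) ℂ ColorSpace :=
  (EuclideanSpace.basisFun (Fin 4) ℂ).prod (dualBasis 4)

lemma inner_isospinBasis (g h : SU 2) (i j : Fin 2 ⊕ Fin 2) :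
    ⟪isospinBasis i, directSumU (tensorU (fund 2 g, (1 : U ℂ)), tensorU ((1 : U ℂ), fund 2 h))
      (isospinBasis j)⟫_ℂ = Matrix.fromBlocks g.1 0 0 h.1 i j := by
  have h1 (A : U (C 2)) (x : C 2) :
      tensorU (A, (1 : U ℂ)) (x ⊗ₜ[ℂ] (1 : ℂ)) = A x ⊗ₜ[ℂ] (1 : ℂ) := rfl
  have h2 (A : U (C 2)) (x : C 2) :
      tensorU ((1 : U ℂ), A) ((1 : ℂ) ⊗ₜ[ℂ] x) = (1 : ℂ) ⊗ₜ[ℂ] A x := rfl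
  rw [isospinBasis, inner_prod_directSumU]
  congr 1
  · ext i j
    rw [Matrix.of_apply, ← inner_basisFun_fund, OrthonormalBasis.map_apply,
      OrthonormalBasis.map_apply]
    change ⟪_ ⊗ₜ[ℂ] (1 : ℂ), tensorU (fund 2 g, (1 : U ℂ)) (_ ⊗ₜ[ℂ] (1 : ℂ))⟫_ℂ = _
    rw [h1, TensorProduct.inner_tmul]
    simp
  · ext i j
    rw [Matrix.of_apply, ← inner_basisFun_fund, OrthonormalBasis.map_apply,
      OrthonormalBasis.map_apply]
    change ⟪(1 : ℂ) ⊗ₜ[ℂ] _, tensorU ((1 : U ℂ), fund 2 h) ((1 : ℂ) ⊗ₜ[ℂ] _)⟫_ℂ = _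
    rw [h2, TensorProduct.inner_tmul]
    simp

lemma inner_colorBasis (g : SU 4) (i j : Fin 4 ⊕ Fin 4) :
    ⟪colorBasis i, directSumU (fund 4 g, dualU (fund 4 g)) (colorBasis j)⟫_ℂ =
      Matrix.fromBlocks g.1 0 0 (g.1.map star) i j := by
  rw [colorBasis, inner_prod_directSumU]
  congr 1
  · ext i j
    exact inner_basisFun_fund g i j
  · ext i j
    exact inner_dualBasis_dualU g i j

/-- The unitary operator `((ℂ² ⊗ ℂ) ⊕ (ℂ ⊗ ℂ²)) ⊗ (ℂ⁴ ⊕ ℂ⁴*) → Λℂ² ⊗ Λℂ³`. -/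
def spinorEquiv : PatiSalamSpace ≃ₗᵢ[ℂ] Ext 2 ⊗[ℂ] Ext 3 :=
  TensorProduct.congrIsometry (isospinBasis.equiv spinorBasis₂ (Equiv.refl _))
    (colorBasis.equiv spinorBasis₃ (Equiv.refl _))

lemma unitaryConj_congrIsometry_tensorU {V V' W W' : Type*} [NormedAddCommGroup V]
    [InnerProductSpace ℂ V] [NormedAddCommGroup W] [InnerProductSpace ℂ W]
    [NormedAddCommGroup V'] [InnerProductSpace ℂ V'] [NormedAddCommGroup W']
    [InnerProductSpace ℂ W'] (k : V ≃ₗᵢ[ℂ] V') (l : W ≃ₗᵢ[ℂ] W') {A : U V} {B : U W} {A' : U V'}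
    {B' : U W'} (hA : ∀ x, k (A x) = A' (k x)) (hB : ∀ x, l (B x) = B' (l x)) :
    unitaryConj (TensorProduct.congrIsometry k l) (tensorU (A, B)) = tensorU (A', B') := by
  refine LinearIsometryEquiv.ext fun x => ?_
  induction x using TensorProduct.induction_on with
  | zero => rw [map_zero, map_zero]
  | tmul x y =>
    change k (A (k.symm x)) ⊗ₜ[ℂ] l (B (l.symm y)) = A' x ⊗ₜ[ℂ] B' y
    rw [hA, hB, LinearIsometryEquiv.apply_symm_apply, LinearIsometryEquiv.apply_symm_apply]
  | add x y hx hy => rw [map_add, map_add, hx, hy]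

end PatiSalam

end

theorem theorem4 (e₄ : Fin 2 ⊕ Fin 2 ≃ Fin 4) (e₆ : Fin 3 ⊕ Fin 3 ≃ Fin 6) :
    ∃ (α : PatiSalam.SU 2 × PatiSalam.SU 2 × PatiSalam.SU 4 ≃* PatiSalam.Spin 4 × PatiSalam.Spin 6)
      (k : PatiSalam.PatiSalamSpace ≃ₗᵢ[ℂ] PatiSalam.Ext 2 ⊗[ℂ] PatiSalam.Ext 3),
      PatiSalam.IsLieGroupIso PatiSalam.suIncl PatiSalam.spinIncl α ∧
      (PatiSalam.unitaryConj k).comp PatiSalam.patiSalamRep =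
        (PatiSalam.spinorTensorRep e₄ e₆).comp α.toMonoidHom := by
  open PatiSalam in
  obtain ⟨β₄, h₄⟩ := exists_spin4_mulEquiv e₄
  obtain ⟨β₆, h₆⟩ := exists_spin6_mulEquiv e₆
  let β : Spin 4 × Spin 6 ≃* SU 2 × SU 2 × SU 4 := (β₄.prodCongr β₆).trans MulEquiv.prodAssoc
  refine ⟨β.symm, spinorEquiv, ?_, ?_⟩
  · refine isLieGroupIso_of_linearMap (halfSpinors e₄ e₆)
      ((CliffordAlgebra.evenOdd (negForm 4) 0).prod (CliffordAlgebra.evenOdd (negForm 6) 0))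
      (fun x => ⟨(spinGroup.mem_iff.1 x.1.2).2, (spinGroup.mem_iff.1 x.2.2).2⟩)
      (fun x hx => eq_zero_of_halfSpinors_eq_zero e₄ e₆ hx.1 hx.2) fun x => ?_
    change ((β₄ x.1).1.1, (β₄ x.1).2.1, (β₆ x.2).1) =
      (Matrix.toBlocks₁₁ (cliffMatrix e₄ spinorBasis₂ x.1.1),
        Matrix.toBlocks₂₂ (cliffMatrix e₄ spinorBasis₂ x.1.1),
        Matrix.toBlocks₁₁ (cliffMatrix e₆ spinorBasis₃ x.2.1))
    rw [h₄, h₆, Matrix.toBlocks_fromBlocks₁₁, Matrix.toBlocks_fromBlocks₂₂,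
      Matrix.toBlocks_fromBlocks₁₁]
  · refine MonoidHom.ext fun g => ?_
    -- Parametrising by the spin side makes the blocks of `x` available directly; the two tensor
    -- factors are then compared entry by entry.
    obtain ⟨x, rfl⟩ := β.surjective g
    change unitaryConj spinorEquiv (patiSalamRep (β x)) = spinorTensorRep e₄ e₆ (β.symm (β x))
    rw [MulEquiv.symm_apply_apply]
    refine unitaryConj_congrIsometry_tensorU _ _ (equiv_comm_of_inner_eq _ _ _ _ fun i j => ?_)
      (equiv_comm_of_inner_eq _ _ _ _ fun i j => ?_)
    · exact (inner_isospinBasis _ _ i j).trans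
        ((congrFun (congrFun (h₄ x.1) i) j).symm.trans (cliffMatrix_apply ..))
    · exact (inner_colorBasis _ i j).trans
        ((congrFun (congrFun (h₆ x.2) i) j).symm.trans (cliffMatrix_apply ..))
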